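/- For a finite connected simple graph $\Gamma$ and a group $G\le \mathrm{Aut}(\Gamma)$ acting transitively on the arcs (ordered pairs of adjacent vertices) of $\Gamma$, say that $(\Gamma,G)$ is locally-$L$ if, for every vertex $v$, the permutation group induced by the stabiliser $G_v$ on the neighbourhood of $v$ is permutation isomorphic to $L$. A permutation group $L$ is of exponential type if there are a real $b>1$ and locally-$L$ pairs $(\Gamma,G)$ with $|V(\Gamma)|$ arbitrarily large such that $|G_{uv}|\ge b^{|V(\Gamma)|}$ for every arc $(u,v)$ of $\Gamma$ (hence also $|G_v|\ge b^{|V(\Gamma)|}$). Consider the following transitive permutation groups of degree $6$: $A_4(6)$, which is $\mathrm{Alt}(4)$ acting on the cosets of $\langle(1\,2)(3\,4)\rangle$; $S_4(6d)$, which is $\mathrm{Sym}(4)$ acting on the cosets of $\langle(1\,2),(3\,4)\rangle$; and $S_4(6c)$, which is $\mathrm{Sym}(4)$ acting on the cosets of $\langle(1\,2\,3\,4)\rangle$. Let $R=\langle a,b,c,z\mid a^2=b^2=c^2=z^2=[a,z]=[b,z]=[c,z]=1,\ [a,b]=[b,c]=[a,c]=z\rangle$, a group of order $16$, and let $M$ be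 the Möbius–Kantor graph, with vertex set $R$ and each $g$ adjacent to $ag,bg,cg$. For $n\ge 1$ let $e_1,\dots,e_4$ be the standard basis of $(\mathbb Z/n)^4$. Give the consecutive arcs of the $8$-cycle $1,\,c,\,bc,\,bz,\,z,\,cz,\,bcz,\,b,\,1$ of $M$ the voltages $e_1,e_2,e_3,e_4,-e_1,-e_2,-e_3,-e_4$, the reversed arcs the opposite voltages, and all other arcs voltage $0$. Let $\Lambda_n$ be the graph on $R\times(\mathbb Z/n)^4$ in which $(g,x)$ is adjacent to $(h,x+\zeta(g,h))$ whenever $g,h$ are adjacent in $M$, where $\zeta(g,h)$ is the voltage of the arc $(g,h)$. Let $\Gamma_n=\Lambda_n[\overline{K_2}]$ be the lexicographic product of $\Lambda_n$ with the edgeless graph on two vertices. Theorem. Each of $A_4(6)$, $S_4(6d)$ and $S_4(6c)$ is of exponential type. Moreover, there is a real $b>1$ such that for every $n\ge 3$ and each $L\in\{A_4(6),S_4(6d),S_4(6c)\}$ there is a group $G_n\le\mathrm{Aut}(\Gamma_n)$ such that $(\Gamma_n,G_n)$ is locally-$L$ and $|(G_n)_{uv}|\ge b^{|V(\Gamma_n)|}$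 for every arc $(u,v)$ of $\Gamma_n$. -/

import Mathlib

/-! ### Permutation groups and local actions -/

/-- Two permutation groups are permutation isomorphic: some bijection of the underlying sets
carries one onto the other. -/
def PermIsomorphic {Ω Δ : Type*} (L : Subgroup (Equiv.Perm Ω)) (M : Subgroup (Equiv.Perm Δ)) :
    Prop :=
  ∃ e : Ω ≃ Δ, M = L.map e.permCongrHom.toMonoidHom

/-- The permutation group induced by `G` on the cosets of its subgroup `H`. -/
def cosetPermGroup (G : Type*) [Group G] (H : Subgroup G) : Subgroup (Equiv.Perm (G ⧸ H)) :=
  (MulAction.toPermHom G (G ⧸ H)).range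

/-- The double transposition `(1 2)(3 4)`, written on the points `0, 1, 2, 3`. -/
def doubleTransposition : Equiv.Perm (Fin 4) := Equiv.swap 0 1 * Equiv.swap 2 3

theorem doubleTransposition_mem : doubleTransposition ∈ alternatingGroup (Fin 4) := by
  rw [Equiv.Perm.mem_alternatingGroup]
  decide

/-- `A₄(6)`: the alternating group of degree 4 acting on the cosets of `⟨(1 2)(3 4)⟩`. -/
def A4_6 : Subgroup (Equiv.Perm (alternatingGroup (Fin 4) ⧸
    Subgroup.closure {(⟨doubleTransposition, doubleTransposition_mem⟩ :
      alternatingGroup (Fin 4))})) :=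
  cosetPermGroup _ _

/-- `S₄(6d)`: the symmetric group of degree 4 acting on the cosets of `⟨(1 2), (3 4)⟩`. -/
def S4_6d : Subgroup (Equiv.Perm (Equiv.Perm (Fin 4) ⧸
    Subgroup.closure {(Equiv.swap 0 1 : Equiv.Perm (Fin 4)), Equiv.swap 2 3})) :=
  cosetPermGroup _ _

/-- `S₄(6c)`: the symmetric group of degree 4 acting on the cosets of `⟨(1 2 3 4)⟩`. -/
def S4_6c : Subgroup (Equiv.Perm (Equiv.Perm (Fin 4) ⧸
    Subgroup.closure {(finRotate 4 : Equiv.Perm (Fin 4))})) :=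
  cosetPermGroup _ _

section LocalAction

variable {V : Type*} {Γ : SimpleGraph V}

/-- `G` acts transitively on the arcs (ordered pairs of adjacent vertices) of the graph. -/
def IsArcTransitive (G : Subgroup (Γ ≃g Γ)) : Prop :=
  ∀ u v u' v' : V, Γ.Adj u v → Γ.Adj u' v' → ∃ g ∈ G, g u = u' ∧ g v = v'

/-- The arc-stabiliser `G_{uv}`, the pointwise stabiliser of `u` and `v` in `G`. -/
def arcStabilizer (G : Subgroup (Γ ≃g Γ)) (u v : V) : Subgroup (Γ ≃g Γ) where
  carrier := {g | g ∈ G ∧ g u = u ∧ g v = v}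
  one_mem' := ⟨G.one_mem, rfl, rfl⟩
  mul_mem' := by
    rintro g h ⟨hg, hgu, hgv⟩ ⟨hh, hhu, hhv⟩
    exact ⟨G.mul_mem hg hh, by rw [RelIso.mul_apply, hhu, hgu], by rw [RelIso.mul_apply, hhv, hgv]⟩
  inv_mem' := by
    rintro g ⟨hg, hgu, hgv⟩
    refine ⟨G.inv_mem hg, ?_, ?_⟩
    · conv_lhs => rw [← hgu]
      exact RelIso.inv_apply_self g u
    · conv_lhs => rw [← hgv]
      exact RelIso.inv_apply_self g v

/-- The permutation group induced by the vertex-stabiliser `G_v` on the neighbourhood of `v`. -/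
def localAction (G : Subgroup (Γ ≃g Γ)) (v : V) : Subgroup (Equiv.Perm (Γ.neighborSet v)) where
  carrier := {p | ∃ g ∈ G, g v = v ∧ ∀ w : Γ.neighborSet v, ((p w : V)) = g (w : V)}
  one_mem' := ⟨1, G.one_mem, rfl, fun _ => rfl⟩
  mul_mem' := by
    rintro p q ⟨g, hg, hgv, hp⟩ ⟨h, hh, hhv, hq⟩
    refine ⟨g * h, G.mul_mem hg hh, by rw [RelIso.mul_apply, hhv, hgv], fun w => ?_⟩
    rw [Equiv.Perm.mul_apply, hp, hq, RelIso.mul_apply]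
  inv_mem' := by
    rintro p ⟨g, hg, hgv, hp⟩
    refine ⟨g⁻¹, G.inv_mem hg, ?_, fun w => ?_⟩
    · conv_lhs => rw [← hgv]
      exact RelIso.inv_apply_self g v
    · have h := hp (p⁻¹ w)
      rw [show p (p⁻¹ w) = w from p.apply_symm_apply w] at h
      rw [h, RelIso.inv_apply_self]

/-- The pair `(Γ, G)` is locally-`L`: `Γ` is finite, connected and `G`-arc-transitive, and
at each vertex `v` the group induced by `G_v` on the neighbourhood of `v` is permutation
isomorphic to `L`. -/
structure IsLocally {Ω : Type*} (L : Subgroup (Equiv.Perm Ω)) (Γ : SimpleGraph V)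
    (G : Subgroup (Γ ≃g Γ)) : Prop where
  finite : Finite V
  connected : Γ.Connected
  arcTransitive : IsArcTransitive G
  localAction_iso : ∀ v : V, PermIsomorphic L (localAction G v)

end LocalAction

/-- `L` is of exponential type: for some base `b > 1` there are locally-`L` pairs `(Γ, G)` with
arbitrarily many vertices in which every arc-stabiliser has order at least `b ^ |V(Γ)|`. -/
def IsOfExponentialType {Ω : Type*} (L : Subgroup (Equiv.Perm Ω)) : Prop :=
  ∃ b : ℝ, 1 < b ∧ ∀ N : ℕ, ∃ (V : Type) (Γ : SimpleGraph V) (G : Subgroup (Γ ≃g Γ)),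
    IsLocally L Γ G ∧ N ≤ Nat.card V ∧
      ∀ u v : V, Γ.Adj u v → b ^ Nat.card V ≤ (Nat.card (arcStabilizer G u v) : ℝ)

/-! ### The group `R` of order 16 and the Möbius–Kantor graph -/

/-- The group `R = ⟨a, b, c, z ∣ a² = b² = c² = z² = [a,z] = [b,z] = [c,z] = 1,
[a,b] = [b,c] = [a,c] = z⟩` of order 16: the quadruple `(i, j, k, l)` stands for
`aⁱ bʲ cᵏ zˡ`. -/
@[ext]
structure MKGroup where
  i : ZMod 2
  j : ZMod 2
  k : ZMod 2
  l : ZMod 2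
  deriving DecidableEq

namespace MKGroup

/-- An element of `R` is determined by its four exponents. -/
def equivProd : MKGroup ≃ ZMod 2 × ZMod 2 × ZMod 2 × ZMod 2 where
  toFun g := (g.i, g.j, g.k, g.l)
  invFun p := ⟨p.1, p.2.1, p.2.2.1, p.2.2.2⟩
  left_inv _ := rfl
  right_inv _ := rfl

instance : Fintype MKGroup := Fintype.ofEquiv _ equivProd.symm

instance : Mul MKGroup where
  mul g h := ⟨g.i + h.i, g.j + h.j, g.k + h.k,
    g.l + h.l + g.j * h.i + g.k * h.i + g.k * h.j⟩

instance : One MKGroup where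
  one := ⟨0, 0, 0, 0⟩

instance : Inv MKGroup where
  inv g := ⟨g.i, g.j, g.k, g.l + g.j * g.i + g.k * g.i + g.k * g.j⟩

theorem mul_def (g h : MKGroup) : g * h = ⟨g.i + h.i, g.j + h.j, g.k + h.k,
    g.l + h.l + g.j * h.i + g.k * h.i + g.k * h.j⟩ := rfl

theorem one_def : (1 : MKGroup) = ⟨0, 0, 0, 0⟩ := rfl

instance : Group MKGroup :=
  Group.ofLeftAxioms
    (fun x y w => by ext <;> simp only [mul_def] <;> ring)
    (fun x => by ext <;> simp [mul_def, one_def])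
    (by decide)

/-- The generator `a` of `R`. -/
def a : MKGroup := ⟨1, 0, 0, 0⟩
/-- The generator `b` of `R`. -/
def b : MKGroup := ⟨0, 1, 0, 0⟩
/-- The generator `c` of `R`. -/
def c : MKGroup := ⟨0, 0, 1, 0⟩
/-- The central generator `z` of `R`. -/
def z : MKGroup := ⟨0, 0, 0, 1⟩

open scoped commutatorElement in
/-- The defining relations of `R`. -/
theorem relations : a ^ 2 = 1 ∧ b ^ 2 = 1 ∧ c ^ 2 = 1 ∧ z ^ 2 = 1 ∧ ⁅a, z⁆ = 1 ∧ ⁅b, z⁆ = 1 ∧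
    ⁅c, z⁆ = 1 ∧ ⁅a, b⁆ = z ∧ ⁅b, c⁆ = z ∧ ⁅a, c⁆ = z := by
  decide

theorem eq_normalForm : ∀ g : MKGroup,
    g = a ^ g.i.val * b ^ g.j.val * c ^ g.k.val * z ^ g.l.val := by
  decide

end MKGroup

/-- The Möbius–Kantor graph `Cay(R, {a, b, c})`: `g` is adjacent to `ag`, `bg` and `cg`. -/
def mobiusKantor : SimpleGraph MKGroup where
  Adj g h := h * g⁻¹ = MKGroup.a ∨ h * g⁻¹ = MKGroup.b ∨ h * g⁻¹ = MKGroup.c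
  symm := ⟨by decide⟩
  loopless := ⟨by decide⟩

/-! ### The graphs `Λₙ` and `Γₙ` -/

/-- The derived covering graph of `Γ` for the voltage assignment `ζ` with values in the (additively
written) group `N`: the vertex `(u, x)` is adjacent to `(v, x + ζ u v)` whenever `u` is adjacent
to `v`. -/
def derivedCover {V N : Type*} [AddCommGroup N] (Γ : SimpleGraph V) (ζ : V → V → N)
    (hζ : ∀ u v, ζ v u = -ζ u v) : SimpleGraph (V × N) where
  Adj p q := Γ.Adj p.1 q.1 ∧ q.2 = p.2 + ζ p.1 q.1
  symm := ⟨fun p q h => ⟨h.1.symm, by rw [h.2, hζ p.1 q.1, add_neg_cancel_right]⟩⟩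
  loopless := ⟨fun p h => Γ.irrefl h.1⟩

/-- The vertices of an 8-cycle of the Möbius–Kantor graph, in cyclic order. -/
def mkCycle : Fin 8 → MKGroup :=
  ![1, .c, .b * .c, .b * .z, .z, .c * .z, .b * .c * .z, .b]

/-- The voltages `e₁, e₂, e₃, e₄, -e₁, -e₂, -e₃, -e₄` in `(ℤ/n)⁴` of the consecutive arcs of the
8-cycle. -/
def mkCycleVoltage (n : ℕ) : Fin 8 → (Fin 4 → ZMod n) :=
  ![Pi.single 0 1, Pi.single 1 1, Pi.single 2 1, Pi.single 3 1,
    -Pi.single 0 1, -Pi.single 1 1, -Pi.single 2 1, -Pi.single 3 1]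

/-- The voltage assignment on the Möbius–Kantor graph: the arc from `mkCycle i` to
`mkCycle (i + 1)` has voltage `mkCycleVoltage n i`, the reverse arc has the opposite voltage, and
all other arcs have trivial voltage. -/
def mkVoltage (n : ℕ) (u v : MKGroup) : Fin 4 → ZMod n :=
  ∑ i : Fin 8, ((if u = mkCycle i ∧ v = mkCycle (i + 1) then mkCycleVoltage n i else 0) -
    (if v = mkCycle i ∧ u = mkCycle (i + 1) then mkCycleVoltage n i else 0))

theorem mkVoltage_symm (n : ℕ) (u v : MKGroup) : mkVoltage n v u = -mkVoltage n u v := by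
  rw [mkVoltage, mkVoltage, ← Finset.sum_neg_distrib]
  exact Finset.sum_congr rfl fun i _ => (neg_sub _ _).symm

/-- The cubic graph `Λₙ`: the derived cover of the Möbius–Kantor graph with voltage group
`(ℤ/n)⁴`. -/
def Lam (n : ℕ) : SimpleGraph (MKGroup × (Fin 4 → ZMod n)) :=
  derivedCover mobiusKantor (mkVoltage n) (mkVoltage_symm n)

/-- The lexicographic product `Γ[Δ]`. -/
def lexProduct {V W : Type*} (Γ : SimpleGraph V) (Δ : SimpleGraph W) : SimpleGraph (V × W) where
  Adj p q := Γ.Adj p.1 q.1 ∨ (p.1 = q.1 ∧ Δ.Adj p.2 q.2)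
  symm := ⟨fun _ _ h => h.imp (fun h => h.symm) fun h => ⟨h.1.symm, h.2.symm⟩⟩
  loopless := ⟨fun _ h => h.elim (fun h => Γ.irrefl h) fun h => Δ.irrefl h.2⟩

/-- The 6-valent graph `Γₙ`: the lexicographic product of `Λₙ` with the edgeless graph on two
vertices. -/
def Gam (n : ℕ) : SimpleGraph ((MKGroup × (Fin 4 → ZMod n)) × ZMod 2) :=
  lexProduct (Lam n) (⊥ : SimpleGraph (ZMod 2))

/-- The graph `Γₙ` carries an arc-transitive group `G` of automorphisms with local action `L` all
of whose arc-stabilisers have order at least `b ^ |V(Γₙ)|`. -/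
def GamHasLargeGroup {Ω : Type*} (L : Subgroup (Equiv.Perm Ω)) (b : ℝ) (n : ℕ) : Prop :=
  ∃ G : Subgroup (Gam n ≃g Gam n), IsLocally L (Gam n) G ∧
    ∀ u v, (Gam n).Adj u v →
      b ^ Nat.card ((MKGroup × (Fin 4 → ZMod n)) × ZMod 2) ≤ (Nat.card (arcStabilizer G u v) : ℝ)

/-! Over each vertex of the cubic graph `Lam n` lies a pair of vertices of `Gam n`, and a function
`c : V → 𝔽₂` acts by exchanging the pairs where it equals 1. If `c` lies in the code `C = ker (A +
I)` and vanishes at `v`, it exchanges an even number of the three pairs next to `v`. Combining `C`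
with automorphisms of `Lam n` that permute edge labels by a group `P` gives, locally, `P` extended
by the even sign changes on three pairs: `A₄` or `S₄` on the edges of a tetrahedron for `P = A₃` or
`S₃`. Asking instead that `(A + I) c` be constant, equal to the sign of the label permutation, gives
the rotations of a cube on its faces, which is `S₄(6c)`.

An arc-stabiliser contains a subspace of `C` of codimension at most 2, so `dim C` has to grow
linearly in the number of vertices. This holds as soon as `C` contains one nonzero word of bounded
weight: its images under a vertex-transitive group cover all coordinates (`card_le_mul_finrank`).
Such a word, of weight at most 72, is given explicitly in the `ℤ⁴`-cover and reduced modulo `n`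
(`closedSum_lamCodeword`). Moved by automorphisms, it also realises every even pattern around a
vertex; the bipartition of the graph, on which `A + I` takes the value 1, supplies the odd ones
(`exists_closedSum_eq_const`). The symmetry of `Lam n` comes from three automorphisms of the
Möbius–Kantor graph that lift affinely to the `ℤ⁴`-cover (`exists_permutesLabels_of_affine`). -/

/-! ### Twisted automorphism groups of lexicographic products over labelled cubic graphs. -/

section Labelling

variable {V : Type*}

/-- `s` labels the neighbours of every vertex of `Γ` by `Fin 3`, both arcs of an edge having the
same label. -/
structure IsCubicLabelling (Γ : SimpleGraph V) (s : Fin 3 → V → V) : Prop where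
  adj_iff : ∀ u v, Γ.Adj u v ↔ ∃ k, s k u = v
  injective : ∀ v, Function.Injective fun k => s k v
  involutive : ∀ k, Function.Involutive (s k)

/-- The permutation `h` of the vertices permutes the labels by `σ`. -/
def PermutesLabels (s : Fin 3 → V → V) (h : Equiv.Perm V) (σ : Equiv.Perm (Fin 3)) : Prop :=
  ∀ k v, h (s k v) = s (σ k) (h v)

theorem PermutesLabels.one (s : Fin 3 → V → V) : PermutesLabels s 1 1 := fun _ _ => rfl

theorem PermutesLabels.mul {s : Fin 3 → V → V} {h h' : Equiv.Perm V} {σ σ' : Equiv.Perm (Fin 3)}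
    (hh : PermutesLabels s h σ) (hh' : PermutesLabels s h' σ') :
    PermutesLabels s (h * h') (σ * σ') := fun k v => by
  rw [Equiv.Perm.mul_apply, hh' k v, hh]; rfl

theorem PermutesLabels.inv {s : Fin 3 → V → V} {h : Equiv.Perm V} {σ : Equiv.Perm (Fin 3)}
    (hh : PermutesLabels s h σ) : PermutesLabels s h⁻¹ σ⁻¹ := fun k v => by
  rw [Equiv.Perm.inv_eq_iff_eq, hh]
  simp

/-- The operator `A + I` over `𝔽₂`, where `A` is the adjacency operator of a labelled cubic
graph. -/
def closedSum (s : Fin 3 → V → V) : (V → ZMod 2) →ₗ[ZMod 2] (V → ZMod 2) where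
  toFun c v := c v + ∑ k, c (s k v)
  map_add' c d := by
    funext v
    simp only [Pi.add_apply, Finset.sum_add_distrib]
    ring
  map_smul' x c := by
    funext v
    simp only [Pi.smul_apply, smul_eq_mul, RingHom.id_apply, mul_add, Finset.mul_sum]

theorem closedSum_apply (s : Fin 3 → V → V) (c : V → ZMod 2) (v : V) :
    closedSum s c v = c v + ∑ k, c (s k v) := rfl

/-- A closed neighbourhood has four members, an even number. Adding a constant therefore normalises
a twist to vanish at a chosen vertex without changing its closed sums. -/
theorem closedSum_const (s : Fin 3 → V → V) (x : ZMod 2) : closedSum s (fun _ => x) = 0 := by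
  funext v
  rw [closedSum_apply]
  revert x
  simp only [Finset.sum_const, Finset.card_univ, Fintype.card_fin, Pi.zero_apply]
  decide

theorem closedSum_comp {s : Fin 3 → V → V} {h : Equiv.Perm V} {σ : Equiv.Perm (Fin 3)}
    (hh : PermutesLabels s h σ) (c : V → ZMod 2) :
    closedSum s (c ∘ h) = closedSum s c ∘ h := by
  funext v
  simp only [closedSum_apply, Function.comp_apply, hh _ v]
  rw [Equiv.sum_comp σ fun k => c (s k (h v))]

/-- The labelled graph has a group of label permuting automorphisms that is transitive on
vertices, in which all permutations of the labels occur at each vertex. -/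
def HasTransitiveLabels (s : Fin 3 → V → V) : Prop :=
  ∀ u v σ, ∃ h : Equiv.Perm V, PermutesLabels s h σ ∧ h u = v

/-- The automorphisms `(v, i) ↦ (h v, i + c (h v))` of the lexicographic product, where `h`
permutes labels by some `σ ∈ P` and `(A + I) c` is constant with value `χ σ`. -/
def twistedGroup (Γ : SimpleGraph V) (s : Fin 3 → V → V) (P : Subgroup (Equiv.Perm (Fin 3)))
    (χ : Equiv.Perm (Fin 3) →* Multiplicative (ZMod 2)) :
    Subgroup (lexProduct Γ (⊥ : SimpleGraph (ZMod 2)) ≃g lexProduct Γ (⊥ : SimpleGraph (ZMod 2)))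
    where
  carrier := {f | ∃ (h : Equiv.Perm V) (σ : Equiv.Perm (Fin 3)) (c : V → ZMod 2), σ ∈ P ∧
    PermutesLabels s h σ ∧ closedSum s c = (fun _ => (χ σ).toAdd) ∧
    ∀ p, f p = (h p.1, p.2 + c (h p.1))}
  one_mem' := ⟨1, 1, 0, P.one_mem, .one s, by rw [map_zero, map_one]; rfl, fun p => by simp⟩
  mul_mem' := by
    rintro f f' ⟨h, σ, c, hσ, hh, hc, hf⟩ ⟨h', σ', c', hσ', hh', hc', hf'⟩
    -- Twists are indexed by the image vertex, so the twist of the first factor applied has to be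
    -- transported by `h`.
    refine ⟨h * h', σ * σ', c + c' ∘ ⇑h⁻¹, P.mul_mem hσ hσ', hh.mul hh', ?_, fun p => ?_⟩
    · rw [map_add, closedSum_comp hh.inv, hc, hc', map_mul]
      rfl
    · rw [RelIso.mul_apply, hf', hf]
      have hinv : h⁻¹ (h (h' p.1)) = h' p.1 := by simp
      simp only [Equiv.Perm.mul_apply, Pi.add_apply, Function.comp_apply, hinv]
      rw [add_assoc, add_comm (c' _)]
  inv_mem' := by
    rintro f ⟨h, σ, c, hσ, hh, hc, hf⟩
    refine ⟨h⁻¹, σ⁻¹, -(c ∘ h), P.inv_mem hσ, hh.inv, ?_, fun p => ?_⟩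
    · rw [map_neg, closedSum_comp hh, hc, map_inv]
      rfl
    · rw [show f⁻¹ p = (h⁻¹ p.1, p.2 + (-(c ∘ h)) (h⁻¹ p.1)) ↔
        p = f (h⁻¹ p.1, p.2 + (-(c ∘ h)) (h⁻¹ p.1)) from ⟨fun e => by
          rw [← e, RelIso.apply_inv_self], fun e => by
          conv_lhs => rw [e]
          rw [RelIso.inv_apply_self]⟩, hf]
      simp [add_assoc, CharTwo.add_self_eq_zero]

/-- The lift of a label permuting automorphism, twisted by a function, to the lexicographic
product. -/
def twistedIso {Γ : SimpleGraph V} {s : Fin 3 → V → V} (hs : IsCubicLabelling Γ s)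
    {h : Equiv.Perm V} {σ : Equiv.Perm (Fin 3)} (hh : PermutesLabels s h σ) (c : V → ZMod 2) :
    lexProduct Γ (⊥ : SimpleGraph (ZMod 2)) ≃g lexProduct Γ (⊥ : SimpleGraph (ZMod 2)) where
  toFun p := (h p.1, p.2 + c (h p.1))
  invFun p := (h⁻¹ p.1, p.2 - c p.1)
  left_inv p := by simp
  right_inv p := by simp
  map_rel_iff' := by
    intro p q
    simp only [lexProduct, SimpleGraph.bot_adj, and_false, or_false, Equiv.coe_fn_mk, hs.adj_iff]
    constructor
    · rintro ⟨k, hk⟩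
      refine ⟨σ⁻¹ k, h.injective ?_⟩
      rw [hh, ← hk]
      simp
    · rintro ⟨k, hk⟩
      exact ⟨σ k, by rw [← hh, hk]⟩

theorem twistedIso_mem {Γ : SimpleGraph V} {s : Fin 3 → V → V} (hs : IsCubicLabelling Γ s)
    {h : Equiv.Perm V} {σ : Equiv.Perm (Fin 3)} (hh : PermutesLabels s h σ) {c : V → ZMod 2}
    {P : Subgroup (Equiv.Perm (Fin 3))} {χ : Equiv.Perm (Fin 3) →* Multiplicative (ZMod 2)}
    (hσ : σ ∈ P) (hc : closedSum s c = fun _ => (χ σ).toAdd) :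
    twistedIso hs hh c ∈ twistedGroup Γ s P χ :=
  ⟨h, σ, c, hσ, hh, hc, fun _ => rfl⟩

/-- The signed permutations of three pairs whose underlying permutation `σ` lies in `P` and whose
number of sign changes is congruent to `χ σ`. -/
def signedPermGroup (P : Subgroup (Equiv.Perm (Fin 3)))
    (χ : Equiv.Perm (Fin 3) →* Multiplicative (ZMod 2)) :
    Subgroup (Equiv.Perm (Fin 3 × ZMod 2)) where
  carrier := {p | ∃ σ ∈ P, ∃ e : Fin 3 → ZMod 2, ∑ k, e k = (χ σ).toAdd ∧
    ∀ q, p q = (σ q.1, q.2 + e q.1)}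
  one_mem' := ⟨1, P.one_mem, 0, by simp, fun q => by simp⟩
  mul_mem' := by
    rintro p p' ⟨σ, hσ, e, he, hp⟩ ⟨σ', hσ', e', he', hp'⟩
    refine ⟨σ * σ', P.mul_mem hσ hσ', e ∘ σ' + e', ?_, fun q => ?_⟩
    · simp only [Pi.add_apply, Finset.sum_add_distrib, Function.comp_apply, map_mul, toAdd_mul]
      rw [Equiv.sum_comp σ' e, he, he']
    · rw [Equiv.Perm.mul_apply, hp', hp]
      simp only [Equiv.Perm.mul_apply, Pi.add_apply, Function.comp_apply]
      rw [add_assoc, add_comm (e' _)]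
  inv_mem' := by
    rintro p ⟨σ, hσ, e, he, hp⟩
    refine ⟨σ⁻¹, P.inv_mem hσ, -(e ∘ ⇑σ⁻¹), ?_, fun q => ?_⟩
    · simp only [Pi.neg_apply, Finset.sum_neg_distrib, Function.comp_apply, map_inv, toAdd_inv]
      rw [Equiv.sum_comp σ⁻¹ e, he]
    · rw [Equiv.Perm.inv_eq_iff_eq, hp]
      simp [add_assoc, CharTwo.add_self_eq_zero]

/-- At `u` the word `c₀` has exactly two neighbours of value 1. The nonzero even vectors of `𝔽₂³`
all have weight 2 and are permuted transitively by `S₃`, so an automorphism carrying `v` to `u` with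
suitable label permutation pulls `c₀` back to any nonzero even pattern at `v`. -/
theorem exists_closedSum_eq_zero_of_sum_eq_zero {s : Fin 3 → V → V} (ht : HasTransitiveLabels s)
    {c₀ : V → ZMod 2} (hc₀ : closedSum s c₀ = 0) {u : V} (hu : c₀ u = 0) {l : Fin 3}
    (hl : c₀ (s l u) = 1) (v : V) (e : Fin 3 → ZMod 2) (he : ∑ k, e k = 0) :
    ∃ c, closedSum s c = 0 ∧ c v = 0 ∧ ∀ k, c (s k v) = e k := by
  have key : ∀ e₀ e : Fin 3 → ZMod 2, e₀ ≠ 0 → ∑ k, e₀ k = 0 → ∑ k, e k = 0 →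
      e = 0 ∨ ∃ σ : Equiv.Perm (Fin 3), ∀ k, e₀ (σ k) = e k := by decide
  have h0 := congrFun hc₀ u
  rw [closedSum_apply, hu, zero_add] at h0
  rcases key (fun k => c₀ (s k u)) e (fun h => one_ne_zero (hl.symm.trans (congrFun h l))) h0 he
    with rfl | ⟨σ, hσ⟩
  · exact ⟨0, map_zero _, rfl, fun _ => rfl⟩
  · obtain ⟨h, hh, hv⟩ := ht v u σ
    refine ⟨c₀ ∘ h, ?_, ?_, fun k => ?_⟩
    · rw [closedSum_comp hh, hc₀]; rfl
    · rw [Function.comp_apply, hv, hu]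
    · rw [Function.comp_apply, hh, hv, hσ]

/-- The function `c` with constant `(A + I) c` may be prescribed on the neighbours of a vertex. -/
theorem exists_closedSum_eq_const {s : Fin 3 → V → V} (ht : HasTransitiveLabels s)
    {c₀ : V → ZMod 2} (hc₀ : closedSum s c₀ = 0) {u : V} (hu : c₀ u = 0) {l : Fin 3}
    (hl : c₀ (s l u) = 1) {w : V → ZMod 2} (hw : closedSum s w = 1)
    (v : V) (e : Fin 3 → ZMod 2) :
    ∃ c, closedSum s c = (fun _ => ∑ k, e k) ∧ c v = 0 ∧ ∀ k, c (s k v) = e k := by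
  set x := ∑ k, e k with hx
  -- `d` accounts for the parity of `e` and vanishes at `v`; what remains is an even pattern.
  set d : V → ZMod 2 := x • w - fun _ => x * w v with hd
  have hdT : closedSum s d = fun _ => x := by
    rw [hd, map_sub, closedSum_const, map_smul, hw, sub_zero]
    funext; simp
  have hdv : d v = 0 := by simp [hd]
  obtain ⟨c, hc, hcv, hce⟩ := exists_closedSum_eq_zero_of_sum_eq_zero ht hc₀ hu hl v
    (fun k => e k - d (s k v)) (by
      have := congrFun hdT v
      rw [closedSum_apply, hdv, zero_add] at this
      rw [Finset.sum_sub_distrib, this, ← hx, sub_self])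
  refine ⟨c + d, by rw [map_add, hc, hdT, zero_add], by rw [Pi.add_apply, hcv, hdv, zero_add],
    fun k => ?_⟩
  rw [Pi.add_apply, hce, sub_add_cancel]

theorem lexProduct_bot_adj {W : Type*} (Γ : SimpleGraph V) (p q : V × W) :
    (lexProduct Γ (⊥ : SimpleGraph W)).Adj p q ↔ Γ.Adj p.1 q.1 := by
  simp [lexProduct]

theorem isArcTransitive_twistedGroup {Γ : SimpleGraph V} {s : Fin 3 → V → V}
    (hs : IsCubicLabelling Γ s) (ht : HasTransitiveLabels s)
    {c₀ : V → ZMod 2} (hc₀ : closedSum s c₀ = 0) {u : V} (hu : c₀ u = 0) {l : Fin 3}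
    (hl : c₀ (s l u) = 1) {w : V → ZMod 2} (hw : closedSum s w = 1)
    {P : Subgroup (Equiv.Perm (Fin 3))} (hP : ∀ k l, ∃ σ ∈ P, σ k = l)
    (χ : Equiv.Perm (Fin 3) →* Multiplicative (ZMod 2)) :
    IsArcTransitive (twistedGroup Γ s P χ) := by
  rintro ⟨u, i⟩ ⟨v, j⟩ ⟨u', i'⟩ ⟨v', j'⟩ huv huv'
  rw [lexProduct_bot_adj, hs.adj_iff] at huv huv'
  obtain ⟨k, rfl : s k u = v⟩ := huv
  obtain ⟨k', rfl : s k' u' = v'⟩ := huv'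
  obtain ⟨σ, hσ, rfl⟩ := hP k k'
  obtain ⟨h, hh, rfl⟩ := ht u u' σ
  have key : ∀ (k : Fin 3) (x y : ZMod 2), ∃ e : Fin 3 → ZMod 2, ∑ k, e k = x ∧ e k = y := by
    decide
  -- Only one neighbour's value matters for the arc; the other two leave room to meet the parity
  -- condition. The constant `i' - i` added below moves `i` to `i'`.
  obtain ⟨e, he, hek⟩ := key (σ k) (χ σ).toAdd ((j' - j) - (i' - i))
  obtain ⟨c, hc, hcv, hce⟩ := exists_closedSum_eq_const ht hc₀ hu hl hw (h u) e
  refine ⟨twistedIso hs hh (c + fun _ => i' - i), twistedIso_mem hs hh hσ ?_, ?_, ?_⟩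
  · rw [map_add, closedSum_const, add_zero, hc, he]
  · change (h u, i + (c (h u) + (i' - i))) = _
    rw [hcv]; simp
  · change (h (s k u), j + (c (h (s k u)) + (i' - i))) = _
    rw [hh, hce, hek]; simp

/-- The neighbours of a vertex of the lexicographic product. -/
noncomputable def neighborEquiv {Γ : SimpleGraph V} {s : Fin 3 → V → V}
    (hs : IsCubicLabelling Γ s) (p : V × ZMod 2) :
    Fin 3 × ZMod 2 ≃ (lexProduct Γ (⊥ : SimpleGraph (ZMod 2))).neighborSet p :=
  Equiv.ofBijective (fun q => ⟨(s q.1 p.1, q.2), by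
      rw [SimpleGraph.mem_neighborSet, lexProduct_bot_adj, hs.adj_iff]; exact ⟨_, rfl⟩⟩) <| by
    constructor
    · rintro ⟨k, j⟩ ⟨k', j'⟩ h
      simp only [Subtype.mk.injEq, Prod.mk.injEq] at h
      exact Prod.ext (hs.injective _ h.1) h.2
    · rintro ⟨⟨v, j⟩, h⟩
      rw [SimpleGraph.mem_neighborSet, lexProduct_bot_adj, hs.adj_iff] at h
      obtain ⟨k, rfl : s k p.1 = v⟩ := h
      exact ⟨(k, j), rfl⟩

theorem coe_neighborEquiv {Γ : SimpleGraph V} {s : Fin 3 → V → V}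
    (hs : IsCubicLabelling Γ s) (p : V × ZMod 2) (q : Fin 3 × ZMod 2) :
    (neighborEquiv hs p q : V × ZMod 2) = (s q.1 p.1, q.2) := rfl

theorem permIsomorphic_localAction_twistedGroup {Γ : SimpleGraph V} {s : Fin 3 → V → V}
    (hs : IsCubicLabelling Γ s) (ht : HasTransitiveLabels s)
    {c₀ : V → ZMod 2} (hc₀ : closedSum s c₀ = 0) {u : V} (hu : c₀ u = 0) {l : Fin 3}
    (hl : c₀ (s l u) = 1) {w : V → ZMod 2} (hw : closedSum s w = 1)
    (P : Subgroup (Equiv.Perm (Fin 3)))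
    (χ : Equiv.Perm (Fin 3) →* Multiplicative (ZMod 2)) (p : V × ZMod 2) :
    PermIsomorphic (signedPermGroup P χ) (localAction (twistedGroup Γ s P χ) p) := by
  refine ⟨neighborEquiv hs p, ?_⟩
  ext g
  rw [Subgroup.mem_map]
  constructor
  · rintro ⟨f, ⟨h, σ, c, hσ, hh, hc, hf⟩, hfp, hg⟩
    rw [hf, Prod.ext_iff] at hfp
    obtain ⟨hp : h p.1 = p.1, hcp⟩ := hfp
    simp only [hp, add_eq_left] at hcp
    -- The sign of the pair `k` is the twist at its image, the pair `σ k`; the converse uses `e ∘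
    -- σ⁻¹` for the same reason.
    refine ⟨(neighborEquiv hs p).symm.permCongr g, ⟨σ, hσ, fun k => c (s (σ k) p.1), ?_, ?_⟩, ?_⟩
    · have := congrFun hc p.1
      rw [closedSum_apply, hcp, zero_add] at this
      rw [Equiv.sum_comp σ fun k => c (s k p.1), this]
    · intro q
      rw [Equiv.permCongr_apply, Equiv.symm_apply_eq, Equiv.symm_symm, ← Subtype.coe_inj, hg, hf,
        coe_neighborEquiv, coe_neighborEquiv, hh, hp]
    · ext1 x
      simp [Equiv.permCongrHom, Equiv.permCongr_apply]
  · rintro ⟨g, ⟨σ, hσ, e, he, hg⟩, rfl⟩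
    obtain ⟨h, hh, hp⟩ := ht p.1 p.1 σ
    obtain ⟨c, hc, hcv, hce⟩ := exists_closedSum_eq_const ht hc₀ hu hl hw p.1 (e ∘ ⇑σ⁻¹)
    refine ⟨twistedIso hs hh c, twistedIso_mem hs hh hσ ?_, ?_, ?_⟩
    · rw [hc]
      simp only [Function.comp_apply]
      rw [Equiv.sum_comp σ⁻¹ e, he]
    · change (h p.1, p.2 + c (h p.1)) = p
      rw [hp, hcv, add_zero]
    · intro x
      obtain ⟨q, rfl⟩ := (neighborEquiv hs p).surjective x
      simp only [Equiv.permCongrHom, MulEquiv.toMonoidHom_eq_coe, MonoidHom.coe_coe,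
        MulEquiv.coe_mk, Equiv.permCongr_apply, Equiv.symm_apply_apply, coe_neighborEquiv, hg]
      change _ = (h (s q.1 p.1), q.2 + c (h (s q.1 p.1)))
      rw [hh, hp, hce]
      simp

/-- Each step of a walk may end in any layer, so a nontrivial walk in `Γ` lifts with arbitrary end
layers. Two points over the same vertex are joined through a neighbour. -/
theorem connected_lexProduct {W : Type*} [Nonempty W] {Γ : SimpleGraph V} (hΓ : Γ.Connected)
    (hn : ∀ v, ∃ w, Γ.Adj v w) : (lexProduct Γ (⊥ : SimpleGraph W)).Connected := by
  have key : ∀ u v : V, ∀ i j : W, Γ.Reachable u v → u ≠ v →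
      (lexProduct Γ (⊥ : SimpleGraph W)).Reachable (u, i) (v, j) := by
    rintro u v i j ⟨p⟩
    induction p generalizing i with
    | nil => exact fun h => absurd rfl h
    | @cons u x v h p ih =>
      intro _
      by_cases hx : x = v
      · subst hx
        exact SimpleGraph.Adj.reachable ((lexProduct_bot_adj Γ _ _).2 h)
      · exact (SimpleGraph.Adj.reachable ((lexProduct_bot_adj Γ (u, i) (x, i)).2 h)).trans
          (ih i hx)
  have := hΓ.nonempty
  refine ⟨?_⟩
  rintro ⟨u, i⟩ ⟨v, j⟩
  by_cases huv : u = v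
  · subst huv
    obtain ⟨w, hw⟩ := hn u
    exact (SimpleGraph.Adj.reachable ((lexProduct_bot_adj Γ (u, i) (w, j)).2 hw)).trans
      (SimpleGraph.Adj.reachable ((lexProduct_bot_adj Γ (w, j) (u, j)).2 hw.symm))
  · exact key u v i j (hΓ.preconnected u v) huv

/-! ### The dimension of the code and the order of arc-stabilisers. -/

/-- If every coordinate is covered by a word of weight at most `m` in a linear code, then the
length of the code is at most `m` times its dimension. -/
theorem card_le_mul_finrank {K : Type*} [Field K] [DecidableEq K] [Fintype V]
    (C : Submodule K (V → K)) (m : ℕ)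
    (hC : ∀ v, ∃ c ∈ C, c v ≠ 0 ∧ (Finset.univ.filter fun v => c v ≠ 0).card ≤ m) :
    Fintype.card V ≤ m * Module.finrank K C := by
  classical
  set S : Set (V → K) := {c | c ∈ C ∧ (Finset.univ.filter fun v => c v ≠ 0).card ≤ m} with hS
  obtain ⟨B, hBS, hspan, hB⟩ := exists_linearIndependent K S
  have hBfin : B.Finite := hB.setFinite
  have : Fintype B := hBfin.fintype
  have hBC : B.toFinset.card ≤ Module.finrank K C := by
    rw [← finrank_span_set_eq_card hB]
    exact Submodule.finrank_mono (Submodule.span_le.2 fun c hc => (hBS hc).1)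
  -- `B` is a basis of the span of the light words. If all of `B` vanished at `v`, so would every
  -- light word; hence the supports of `B` cover all coordinates.
  have hcover : (Finset.univ : Finset V) ⊆
      B.toFinset.biUnion fun c => Finset.univ.filter fun v => c v ≠ 0 := by
    intro v _
    by_contra hv
    simp only [Finset.mem_biUnion, Set.mem_toFinset, Finset.mem_filter, Finset.mem_univ, true_and,
      not_exists, not_and, not_not] at hv
    obtain ⟨c, hc, hcv, hcm⟩ := hC v
    have hle : Submodule.span K B ≤ LinearMap.ker (LinearMap.proj (R := K) (φ := fun _ => K) v) :=
      Submodule.span_le.2 fun d hd => hv d hd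
    exact hcv (hle (hspan ▸ Submodule.subset_span ⟨hc, hcm⟩))
  calc Fintype.card V = (Finset.univ : Finset V).card := rfl
    _ ≤ _ := Finset.card_le_card hcover
    _ ≤ B.toFinset.card * m := Finset.card_biUnion_le_card_mul _ _ _ fun c hc =>
        (hBS (Set.mem_toFinset.1 hc)).2
    _ ≤ m * Module.finrank K C := by rw [mul_comm]; exact Nat.mul_le_mul_left _ hBC

theorem card_le_mul_finrank_ker_closedSum [Fintype V] {s : Fin 3 → V → V}
    (ht : HasTransitiveLabels s) {c₀ : V → ZMod 2} (hc₀ : closedSum s c₀ = 0) {u : V}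
    (hu : c₀ u = 1) {m : ℕ} (hm : (Finset.univ.filter fun v => c₀ v ≠ 0).card ≤ m) :
    Fintype.card V ≤ m * Module.finrank (ZMod 2) (LinearMap.ker (closedSum s)) := by
  refine card_le_mul_finrank _ m fun v => ?_
  obtain ⟨h, hh, hv⟩ := ht v u 1
  refine ⟨c₀ ∘ h, ?_, ?_, le_trans (le_of_eq ?_) hm⟩
  · rw [LinearMap.mem_ker, closedSum_comp hh, hc₀]; rfl
  · rw [Function.comp_apply, hv, hu]; exact one_ne_zero
  · refine Finset.card_bij (fun v _ => h v) (by simp) (fun _ _ _ _ e => h.injective e) ?_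
    intro w hw
    exact ⟨h⁻¹ w, by simpa using hw, by simp⟩

/-- Codewords vanishing at both ends of the arc act faithfully over the identity of `Γ`. Vanishing
at two vertices costs at most two dimensions. -/
theorem two_pow_le_card_arcStabilizer [Finite V] {Γ : SimpleGraph V} {s : Fin 3 → V → V}
    (hs : IsCubicLabelling Γ s) (P : Subgroup (Equiv.Perm (Fin 3)))
    (χ : Equiv.Perm (Fin 3) →* Multiplicative (ZMod 2)) (p q : V × ZMod 2) :
    2 ^ (Module.finrank (ZMod 2) (LinearMap.ker (closedSum s)) - 2) ≤
      Nat.card (arcStabilizer (twistedGroup Γ s P χ) p q) := by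
  set C := LinearMap.ker (closedSum s) with hC
  let ev : C →ₗ[ZMod 2] ZMod 2 × ZMod 2 :=
    ((LinearMap.proj p.1).prod (LinearMap.proj q.1)).comp C.subtype
  have hev : Module.finrank (ZMod 2) C - 2 ≤ Module.finrank (ZMod 2) (LinearMap.ker ev) := by
    have h1 := LinearMap.finrank_range_add_finrank_ker ev
    have h2 := Submodule.finrank_le (LinearMap.range ev)
    rw [Module.finrank_prod, Module.finrank_self] at h2
    omega
  calc 2 ^ (Module.finrank (ZMod 2) C - 2) ≤ 2 ^ Module.finrank (ZMod 2) (LinearMap.ker ev) :=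
        Nat.pow_le_pow_right two_pos hev
    _ = Nat.card (LinearMap.ker ev) := by
        rw [Module.natCard_eq_pow_finrank (K := ZMod 2), Nat.card_zmod]
    _ ≤ _ := by
      have hmem : ∀ c : LinearMap.ker ev, twistedIso hs (.one s) (c : V → ZMod 2) ∈
          arcStabilizer (twistedGroup Γ s P χ) p q := by
        rintro ⟨⟨c, hc⟩, hpq⟩
        have hpq' : (c p.1, c q.1) = (0, 0) := hpq
        rw [Prod.mk.injEq] at hpq'
        refine ⟨twistedIso_mem hs _ P.one_mem ?_, ?_, ?_⟩
        · rw [LinearMap.mem_ker.1 hc, map_one]; rfl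
        · change (p.1, p.2 + c p.1) = p
          rw [hpq'.1, add_zero]
        · change (q.1, q.2 + c q.1) = q
          rw [hpq'.2, add_zero]
      have : Finite (lexProduct Γ (⊥ : SimpleGraph (ZMod 2)) ≃g
          lexProduct Γ (⊥ : SimpleGraph (ZMod 2))) :=
        Finite.of_injective (fun f => (f : V × ZMod 2 → V × ZMod 2)) DFunLike.coe_injective
      refine Nat.card_le_card_of_injective (fun c => (⟨_, hmem c⟩ :
        arcStabilizer (twistedGroup Γ s P χ) p q)) fun c d hcd => ?_
      ext v
      have := congrArg (fun f => ((f : lexProduct Γ (⊥ : SimpleGraph (ZMod 2)) ≃g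
          lexProduct Γ (⊥ : SimpleGraph (ZMod 2))) (v, 0)).2) (Subtype.ext_iff.1 hcd)
      simpa [twistedIso] using this

end Labelling

/-! ### The three groups of degree 6 as groups of signed permutations. -/

section Models

theorem PermIsomorphic.trans {Ω Δ Θ : Type*} {L : Subgroup (Equiv.Perm Ω)}
    {M : Subgroup (Equiv.Perm Δ)} {N : Subgroup (Equiv.Perm Θ)}
    (h : PermIsomorphic L M) (h' : PermIsomorphic M N) : PermIsomorphic L N := by
  obtain ⟨e, rfl⟩ := h
  obtain ⟨e', rfl⟩ := h'
  exact ⟨e.trans e', by rw [Subgroup.map_map]; rfl⟩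

/-- The action on the cosets of a point stabiliser of a transitive action. -/
theorem permIsomorphic_cosetPermGroup {G Δ : Type*} [Group G] (φ : G →* Equiv.Perm Δ) (x : Δ)
    (hφ : ∀ y, ∃ g, φ g x = y) (H : Subgroup G) (hH : ∀ g, g ∈ H ↔ φ g x = x) :
    PermIsomorphic (cosetPermGroup G H) φ.range := by
  have hinj : ∀ g g' : G, (g : G ⧸ H) = g' ↔ φ g x = φ g' x := fun g g' => by
    rw [QuotientGroup.eq, hH, map_mul, map_inv, Equiv.Perm.mul_apply, Equiv.Perm.inv_eq_iff_eq,
      eq_comm]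
  let e : G ⧸ H ≃ Δ := Equiv.ofBijective
    (Quotient.lift (fun g => φ g x) fun g g' h => (hinj g g').1 (Quotient.sound h)) <| by
      constructor
      · rintro ⟨g⟩ ⟨g'⟩ h
        exact (hinj g g').2 h
      · intro y
        obtain ⟨g, hg⟩ := hφ y
        exact ⟨(g : G ⧸ H), hg⟩
  have he : ∀ g : G, e (g : G ⧸ H) = φ g x := fun _ => rfl
  have hcomm : e.permCongrHom.toMonoidHom.comp (MulAction.toPermHom G (G ⧸ H)) = φ := by
    ext g y
    obtain ⟨g', rfl⟩ := hφ y
    change e (g • e.symm (φ g' x)) = _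
    rw [← he g', Equiv.symm_apply_apply, MulAction.Quotient.smul_coe, he, smul_eq_mul, map_mul]
    rfl
  exact ⟨e, by rw [cosetPermGroup, MonoidHom.map_range, hcomm]⟩

/-- The ends of the edge of the tetrahedron with a given label; opposite edges form a pair. -/
def edgeEnds : Fin 3 × ZMod 2 → Fin 4 × Fin 4 := fun q =>
  if q.2 = 0 then ![(0, 1), (0, 2), (1, 2)] q.1 else ![(2, 3), (1, 3), (0, 3)] q.1

/-- The label of the edge of the tetrahedron with given ends. -/
def edgeLabel (x y : Fin 4) : Fin 3 × ZMod 2 :=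
  (![![0, 0, 1, 2], ![0, 0, 2, 1], ![1, 2, 0, 0], ![2, 1, 0, 0]] x y,
    if x = 3 ∨ y = 3 then 1 else 0)

theorem edgeLabel_map (π : Equiv.Perm (Fin 4)) (x y : Fin 4) (h : x ≠ y) :
    edgeLabel (π (edgeEnds (edgeLabel x y)).1) (π (edgeEnds (edgeLabel x y)).2) =
      edgeLabel (π x) (π y) := by
  have hsymm : ∀ x y, edgeLabel x y = edgeLabel y x := by decide
  have hends : ∀ x y, x ≠ y → edgeEnds (edgeLabel x y) = (x, y) ∨
    edgeEnds (edgeLabel x y) = (y, x) := by decide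
  rcases hends x y h with h | h <;> rw [h]
  exact hsymm _ _

theorem edgeLabel_edgeEnds : ∀ q, edgeLabel (edgeEnds q).1 (edgeEnds q).2 = q := by decide

theorem edgeEnds_ne : ∀ q, (edgeEnds q).1 ≠ (edgeEnds q).2 := by decide

/-- Permutations of the points preserve oppositeness of edges. Since the exchange of opposite edges
is thus central, twisting by it yields a homomorphism. -/
theorem edgeLabel_flip : ∀ (π : Equiv.Perm (Fin 4)) (q : Fin 3 × ZMod 2) (i : ZMod 2),
    edgeLabel (π (edgeEnds (q + (0, i))).1) (π (edgeEnds (q + (0, i))).2) =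
      edgeLabel (π (edgeEnds q).1) (π (edgeEnds q).2) + (0, i) := by
  decide +kernel

/-- The action of `Sym(4)` on the edges of the tetrahedron, in which a permutation of sign `u` is
composed with the exchange of all pairs of opposite edges if `ε u` is nontrivial. -/
def edgeAction (ε : ℤˣ →* Multiplicative (ZMod 2)) :
    Equiv.Perm (Fin 4) →* Equiv.Perm (Fin 3 × ZMod 2) :=
  MonoidHom.toHomPerm
    { toFun := fun π q =>
        edgeLabel (π (edgeEnds q).1) (π (edgeEnds q).2) + (0, (ε (Equiv.Perm.sign π)).toAdd)
      map_one' := funext fun q => by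
        simp only [Equiv.Perm.one_apply, edgeLabel_edgeEnds, map_one]
        exact add_zero q
      map_mul' := fun π π' => funext fun q => by
        change _ = edgeLabel (π (edgeEnds (_ + (0, _))).1) (π (edgeEnds (_ + (0, _))).2) + _
        rw [edgeLabel_flip, edgeLabel_map _ _ _ (π'.injective.ne (edgeEnds_ne q)), map_mul,
          map_mul, toAdd_mul, add_assoc, add_comm (ε _).toAdd]
        simp only [Equiv.Perm.mul_apply, Prod.mk_add_mk, add_zero] }

theorem edgeAction_apply (ε : ℤˣ →* Multiplicative (ZMod 2)) (π : Equiv.Perm (Fin 4))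
    (q : Fin 3 × ZMod 2) : edgeAction ε π q =
      edgeLabel (π (edgeEnds q).1) (π (edgeEnds q).2) + (0, (ε (Equiv.Perm.sign π)).toAdd) := rfl

/-- `σ` is the image of `π` under `S₄ → S₃`, the action on the three pairs of opposite edges, which
preserves signs; the kernel, Klein's four-group, supplies the even sign changes. -/
theorem exists_signedPerm_eq_edgeLabel : ∀ π : Equiv.Perm (Fin 4),
    ∃ (σ : Equiv.Perm (Fin 3)) (e : Fin 3 → ZMod 2), Equiv.Perm.sign σ = Equiv.Perm.sign π ∧
      ∑ k, e k = 0 ∧ ∀ q, edgeLabel (π (edgeEnds q).1) (π (edgeEnds q).2) =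
        (σ q.1, q.2 + e q.1) := by
  decide +kernel

theorem exists_edgeLabel_eq_signedPerm : ∀ (σ : Equiv.Perm (Fin 3)) (e : Fin 3 → ZMod 2),
    ∑ k, e k = 0 → ∃ π : Equiv.Perm (Fin 4), Equiv.Perm.sign π = Equiv.Perm.sign σ ∧
      ∀ q, edgeLabel (π (edgeEnds q).1) (π (edgeEnds q).2) = (σ q.1, q.2 + e q.1) := by
  decide +kernel

theorem mem_signedPermGroup_iff (Q : Subgroup ℤˣ) (ε : ℤˣ →* Multiplicative (ZMod 2))
    (p : Equiv.Perm (Fin 3 × ZMod 2)) :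
    p ∈ signedPermGroup (Q.comap Equiv.Perm.sign) (ε.comp Equiv.Perm.sign) ↔
      ∃ π : Equiv.Perm (Fin 4), Equiv.Perm.sign π ∈ Q ∧ edgeAction ε π = p := by
  -- Exchanging all three pairs changes the parity of the number of sign changes, so the twist by
  -- `ε` turns even sign changes into the parity prescribed by `ε`.
  have hthree : ∀ x : ZMod 2, ∑ _k : Fin 3, x = x := by decide
  constructor
  · rintro ⟨σ, hσ, e, he, hp⟩
    obtain ⟨π, hπ, h⟩ := exists_edgeLabel_eq_signedPerm σ
      (fun k => e k - (ε (Equiv.Perm.sign σ)).toAdd) (by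
        rw [Finset.sum_sub_distrib, he, hthree]; exact sub_self _)
    refine ⟨π, hπ ▸ hσ, Equiv.ext fun q => ?_⟩
    rw [edgeAction_apply, h, hp, hπ, Prod.mk_add_mk, add_zero]
    congr 1
    ring
  · rintro ⟨π, hπ, rfl⟩
    obtain ⟨σ, e, hσ, he, h⟩ := exists_signedPerm_eq_edgeLabel π
    refine ⟨σ, by rwa [Subgroup.mem_comap, hσ], fun k => e k + (ε (Equiv.Perm.sign σ)).toAdd, ?_, fun q => ?_⟩
    · rw [Finset.sum_add_distrib, he, hthree, zero_add]; rfl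
    · rw [edgeAction_apply, h, hσ, Prod.mk_add_mk, add_zero, add_assoc]

theorem exists_alternating_edgeLabel : ∀ x q : Fin 3 × ZMod 2, ∃ π : Equiv.Perm (Fin 4),
    Equiv.Perm.sign π = 1 ∧ edgeLabel (π (edgeEnds x).1) (π (edgeEnds x).2) = q := by
  decide +kernel

/-- The nontrivial homomorphism from `{1, -1}` to `ℤ/2`. -/
def unitsSign : ℤˣ →* Multiplicative (ZMod 2) where
  toFun u := Multiplicative.ofAdd (if u = 1 then 0 else 1)
  map_one' := rfl
  map_mul' := by decide

theorem permIsomorphic_A4_6 : PermIsomorphic A4_6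
    (signedPermGroup ((⊥ : Subgroup ℤˣ).comap Equiv.Perm.sign)
      ((1 : ℤˣ →* Multiplicative (ZMod 2)).comp Equiv.Perm.sign)) := by
  have hrange : signedPermGroup ((⊥ : Subgroup ℤˣ).comap Equiv.Perm.sign)
      ((1 : ℤˣ →* Multiplicative (ZMod 2)).comp Equiv.Perm.sign) =
      ((edgeAction 1).comp (alternatingGroup (Fin 4)).subtype).range := by
    ext p
    rw [mem_signedPermGroup_iff]
    simp [MonoidHom.mem_range, Equiv.Perm.mem_alternatingGroup]
  rw [hrange]
  refine permIsomorphic_cosetPermGroup _ (0, 0) (fun y => ?_) _ fun g => ⟨fun hg => ?_, fun hg => ?_⟩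
  · obtain ⟨π, hπ, h⟩ := exists_alternating_edgeLabel (0, 0) y
    refine ⟨⟨π, Equiv.Perm.mem_alternatingGroup.2 hπ⟩, ?_⟩
    simp [edgeAction_apply, h]
  · induction hg using Subgroup.closure_induction with
    | mem x hx =>
      rw [Set.mem_singleton_iff.1 hx]
      decide
    | one => simp
    | mul x y _ _ hx hy => rw [map_mul, Equiv.Perm.mul_apply, hy, hx]
    | inv x _ hx => rw [map_inv, Equiv.Perm.inv_eq_iff_eq, hx]
  · have key : ∀ π : Equiv.Perm (Fin 4), Equiv.Perm.sign π = 1 →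
        edgeLabel (π 0) (π 1) = 0 → π = 1 ∨ π = doubleTransposition := by decide +kernel
    have hg' : edgeLabel ((g : Equiv.Perm (Fin 4)) 0) ((g : Equiv.Perm (Fin 4)) 1) = 0 := by
      simpa [edgeAction_apply, edgeEnds] using hg
    rcases key g (Equiv.Perm.mem_alternatingGroup.1 g.2) hg' with h | h
    · rw [show g = 1 from Subtype.ext h]; exact one_mem _
    · rw [show g = ⟨_, doubleTransposition_mem⟩ from Subtype.ext h]
      exact Subgroup.subset_closure rfl

theorem signedPermGroup_eq_range_edgeAction (ε : ℤˣ →* Multiplicative (ZMod 2)) :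
    signedPermGroup ((⊤ : Subgroup ℤˣ).comap Equiv.Perm.sign) (ε.comp Equiv.Perm.sign) =
      (edgeAction ε).range := by
  ext p
  rw [mem_signedPermGroup_iff]
  simp [MonoidHom.mem_range]

theorem exists_edgeAction_apply_eq (ε : ℤˣ →* Multiplicative (ZMod 2)) (x q : Fin 3 × ZMod 2) :
    ∃ π, edgeAction ε π x = q := by
  obtain ⟨π, hπ, h⟩ := exists_alternating_edgeLabel x q
  refine ⟨π, ?_⟩
  rw [edgeAction_apply, hπ, h, map_one]
  exact add_zero q

theorem permIsomorphic_S4_6d : PermIsomorphic S4_6d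
    (signedPermGroup ((⊤ : Subgroup ℤˣ).comap Equiv.Perm.sign)
      ((1 : ℤˣ →* Multiplicative (ZMod 2)).comp Equiv.Perm.sign)) := by
  rw [signedPermGroup_eq_range_edgeAction]
  refine permIsomorphic_cosetPermGroup _ (0, 0) (exists_edgeAction_apply_eq _ _) _
    fun g => ⟨fun hg => ?_, fun hg => ?_⟩
  · induction hg using Subgroup.closure_induction with
    | mem x hx =>
      rcases hx with rfl | rfl <;> decide
    | one => simp
    | mul x y _ _ hx hy => rw [map_mul, Equiv.Perm.mul_apply, hy, hx]
    | inv x _ hx => rw [map_inv, Equiv.Perm.inv_eq_iff_eq, hx]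
  · have key : ∀ π : Equiv.Perm (Fin 4), edgeLabel (π 0) (π 1) = 0 → π = 1 ∨
        π = Equiv.swap 0 1 ∨ π = Equiv.swap 2 3 ∨ π = Equiv.swap 0 1 * Equiv.swap 2 3 := by
      decide +kernel
    have hg' : edgeLabel (g 0) (g 1) = 0 := by
      simpa [edgeAction_apply, edgeEnds] using hg
    have h1 : (Equiv.swap 0 1 : Equiv.Perm (Fin 4)) ∈
        Subgroup.closure {(Equiv.swap 0 1 : Equiv.Perm (Fin 4)), Equiv.swap 2 3} :=
      Subgroup.subset_closure (Set.mem_insert _ _)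
    have h2 : (Equiv.swap 2 3 : Equiv.Perm (Fin 4)) ∈
        Subgroup.closure {(Equiv.swap 0 1 : Equiv.Perm (Fin 4)), Equiv.swap 2 3} :=
      Subgroup.subset_closure (Set.mem_insert_of_mem _ rfl)
    rcases key g hg' with rfl | rfl | rfl | rfl
    exacts [one_mem _, h1, h2, mul_mem h1 h2]

theorem permIsomorphic_S4_6c : PermIsomorphic S4_6c
    (signedPermGroup ((⊤ : Subgroup ℤˣ).comap Equiv.Perm.sign)
      (unitsSign.comp Equiv.Perm.sign)) := by
  rw [signedPermGroup_eq_range_edgeAction]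
  -- The base edge `{0, 2}` is a diagonal of the 4-cycle `finRotate 4`, which sends it to the
  -- opposite edge `{1, 3}`. As the 4-cycle is odd, the twist brings it back.
  refine permIsomorphic_cosetPermGroup _ (1, 0) (exists_edgeAction_apply_eq _ _) _
    fun g => ⟨fun hg => ?_, fun hg => ?_⟩
  · induction hg using Subgroup.closure_induction with
    | mem x hx =>
      rw [Set.mem_singleton_iff.1 hx]
      decide
    | one => simp
    | mul x y _ _ hx hy => rw [map_mul, Equiv.Perm.mul_apply, hy, hx]
    | inv x _ hx => rw [map_inv, Equiv.Perm.inv_eq_iff_eq, hx]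
  · have key : ∀ π : Equiv.Perm (Fin 4),
        edgeLabel (π (edgeEnds (1, 0)).1) (π (edgeEnds (1, 0)).2) +
          (0, (unitsSign (Equiv.Perm.sign π)).toAdd) = (1, 0) →
        ∃ m : Fin 4, finRotate 4 ^ (m : ℕ) = π := by
      decide +kernel
    rw [edgeAction_apply] at hg
    obtain ⟨m, hm⟩ := key g hg
    rw [← hm]
    exact pow_mem (Subgroup.subset_closure (Set.mem_singleton _)) m

end Models

/-! ### The integral cover, its reduction modulo `n`, and connectedness. -/

section Cover

/-- The generator of `R` with a given label. -/
def labelGen : Fin 3 → MKGroup := ![.a, .b, .c]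

/-- The integral voltages of the consecutive arcs of the 8-cycle. -/
def intCycleVoltage : Fin 8 → (Fin 4 → ℤ) :=
  ![Pi.single 0 1, Pi.single 1 1, Pi.single 2 1, Pi.single 3 1,
    -Pi.single 0 1, -Pi.single 1 1, -Pi.single 2 1, -Pi.single 3 1]

/-- The integral voltage of an arc of the Möbius–Kantor graph. -/
def intVoltage (u v : MKGroup) : Fin 4 → ℤ :=
  ∑ i : Fin 8, ((if u = mkCycle i ∧ v = mkCycle (i + 1) then intCycleVoltage i else 0) -
    (if v = mkCycle i ∧ u = mkCycle (i + 1) then intCycleVoltage i else 0))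

/-- Reduction of integral vectors modulo `n`. -/
def reduceMod (n : ℕ) : (Fin 4 → ℤ) →+ (Fin 4 → ZMod n) where
  toFun x i := x i
  map_zero' := by funext; simp
  map_add' x y := by funext; simp

theorem reduceMod_apply (n : ℕ) (x : Fin 4 → ℤ) (i : Fin 4) : reduceMod n x i = x i := rfl

theorem reduceMod_single (n : ℕ) (i : Fin 4) (x : ℤ) :
    reduceMod n (Pi.single i x) = Pi.single i (x : ZMod n) := by
  funext j
  by_cases h : j = i
  · subst h; simp [reduceMod_apply]
  · simp [reduceMod_apply, h]

theorem reduceMod_mulVec (n : ℕ) (M : Matrix (Fin 4) (Fin 4) ℤ) (x : Fin 4 → ℤ) :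
    reduceMod n (M.mulVec x) = (M.map ((↑) : ℤ → ZMod n)).mulVec (reduceMod n x) :=
  funext fun i => RingHom.map_mulVec (Int.castRingHom (ZMod n)) M x i

theorem reduceMod_surjective (n : ℕ) : Function.Surjective (reduceMod n) := fun x =>
  ⟨fun i => (ZMod.intCast_surjective (x i)).choose,
    funext fun i => (ZMod.intCast_surjective (x i)).choose_spec⟩

/-- This makes all finite verifications independent of `n`: they are carried out once with integral
voltages and then reduced. -/
theorem mkVoltage_eq_reduceMod (n : ℕ) (u v : MKGroup) :
    mkVoltage n u v = reduceMod n (intVoltage u v) := by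
  have hcycle : ∀ i, mkCycleVoltage n i = reduceMod n (intCycleVoltage i) := by
    intro i
    fin_cases i <;> simp [mkCycleVoltage, intCycleVoltage, reduceMod_single]
  rw [mkVoltage, intVoltage, map_sum]
  refine Finset.sum_congr rfl fun i _ => ?_
  rw [map_sub, apply_ite (reduceMod n), apply_ite (reduceMod n), map_zero, hcycle]

/-- The neighbour with a given label in the `ℤ⁴`-cover of the Möbius–Kantor graph. -/
def intNeighbor (k : Fin 3) (p : MKGroup × (Fin 4 → ℤ)) : MKGroup × (Fin 4 → ℤ) :=
  (labelGen k * p.1, p.2 + intVoltage p.1 (labelGen k * p.1))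

/-- The neighbour with a given label in `Lam n`. -/
def lamNeighbor (n : ℕ) (k : Fin 3) (p : MKGroup × (Fin 4 → ZMod n)) :
    MKGroup × (Fin 4 → ZMod n) :=
  (labelGen k * p.1, p.2 + mkVoltage n p.1 (labelGen k * p.1))

/-- Reduction modulo `n` of vertices of the `ℤ⁴`-cover. -/
def reduceVertex (n : ℕ) (p : MKGroup × (Fin 4 → ℤ)) : MKGroup × (Fin 4 → ZMod n) :=
  (p.1, reduceMod n p.2)

theorem lamNeighbor_reduceVertex (n : ℕ) (k : Fin 3) (p : MKGroup × (Fin 4 → ℤ)) :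
    lamNeighbor n k (reduceVertex n p) = reduceVertex n (intNeighbor k p) := by
  simp only [lamNeighbor, reduceVertex, intNeighbor, map_add, mkVoltage_eq_reduceMod]

theorem labelGen_mul_self : ∀ k, labelGen k * labelGen k = 1 := by decide

theorem isCubicLabelling_lamNeighbor (n : ℕ) : IsCubicLabelling (Lam n) (lamNeighbor n) where
  adj_iff := by
    have key : ∀ u v, mobiusKantor.Adj u v ↔ ∃ k, labelGen k * u = v := fun u v => by
      simp only [mobiusKantor, Fin.exists_fin_succ, labelGen, mul_inv_eq_iff_eq_mul, eq_comm (a := v)]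
      simp
    rintro ⟨u, x⟩ ⟨v, y⟩
    change mobiusKantor.Adj u v ∧ y = x + mkVoltage n u v ↔ _
    rw [key]
    constructor
    · rintro ⟨⟨k, rfl⟩, rfl⟩
      exact ⟨k, rfl⟩
    · rintro ⟨k, h⟩
      simp only [lamNeighbor, Prod.mk.injEq] at h
      obtain ⟨rfl, rfl⟩ := h
      exact ⟨⟨k, rfl⟩, rfl⟩
  injective := fun v k l h => by
    have hinj : Function.Injective labelGen := by decide
    exact hinj (mul_right_cancel (congrArg Prod.fst h))
  involutive := fun k p => by
    simp only [lamNeighbor, ← mul_assoc, labelGen_mul_self, one_mul]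
    rw [mkVoltage_symm n p.1, add_neg_cancel_right]

theorem adj_lamNeighbor (n : ℕ) (k : Fin 3) (p : MKGroup × (Fin 4 → ZMod n)) :
    (Lam n).Adj p (lamNeighbor n k p) :=
  ((isCubicLabelling_lamNeighbor n).adj_iff _ _).2 ⟨k, rfl⟩

theorem reachable_foldl_intNeighbor (n : ℕ) (w : List (Fin 3)) (p : MKGroup × (Fin 4 → ℤ)) :
    (Lam n).Reachable (reduceVertex n p)
      (reduceVertex n (w.foldl (fun p k => intNeighbor k p) p)) := by
  induction w generalizing p with
  | nil => exact .rfl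
  | cons k w ih =>
    refine SimpleGraph.Reachable.trans (SimpleGraph.Adj.reachable ?_) (ih (intNeighbor k p))
    rw [← lamNeighbor_reduceVertex]
    exact adj_lamNeighbor n k _

theorem foldl_intNeighbor_translate (w : List (Fin 3)) (g : MKGroup) (x y : Fin 4 → ℤ) :
    w.foldl (fun p k => intNeighbor k p) (g, x + y) =
      ((w.foldl (fun p k => intNeighbor k p) (g, y)).1,
        x + (w.foldl (fun p k => intNeighbor k p) (g, y)).2) := by
  induction w generalizing g y with
  | nil => rfl
  | cons k w ih =>
    rw [List.foldl_cons, List.foldl_cons]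
    change List.foldl _ (_, x + y + _) w = _
    rw [add_assoc, ih]
    rfl

theorem reachable_of_foldl_intNeighbor (n : ℕ) {w : List (Fin 3)} {g h : MKGroup}
    {x : Fin 4 → ℤ} (hw : w.foldl (fun p k => intNeighbor k p) (g, 0) = (h, x))
    (y : Fin 4 → ZMod n) : (Lam n).Reachable (g, y) (h, y + reduceMod n x) := by
  obtain ⟨y, rfl⟩ := reduceMod_surjective n y
  have := reachable_foldl_intNeighbor n w (g, y + 0)
  rw [foldl_intNeighbor_translate, hw, add_zero] at this
  rw [← map_add]
  exact this

theorem exists_walk_to_fibre : ∀ g : MKGroup,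
    ∃ w ∈ ([[], [0, 1, 2, 1, 2, 0], [0, 1, 2, 1, 0], [0, 2, 0],
      [0, 2, 1, 2, 0], [0, 1, 0], [0, 2, 1, 0], [0, 1, 2, 0],
      [0], [0, 1, 2, 1, 2], [0, 1, 2, 1], [0, 2],
      [0, 2, 1, 2], [0, 1], [0, 2, 1], [0, 1, 2]] : List (List (Fin 3))),
      w.foldl (fun p k => intNeighbor k p) (1, 0) = (g, 0) := by
  decide +kernel

/-- The closed walks at the identity realise the generators of the voltage group. Together with the
voltage-free paths of `exists_walk_to_fibre`, they make the cover connected. -/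
theorem exists_walk_translation : ∀ i : Fin 4,
    ∃ w ∈ ([[2, 0, 1, 2, 1, 0], [0, 1, 2, 0, 1, 0, 2, 0],
      [0, 2, 1, 0, 2, 0, 1, 0], [1, 0, 2, 1, 2, 0]] : List (List (Fin 3))),
      w.foldl (fun p k => intNeighbor k p) (1, 0) = (1, Pi.single i 1) := by
  decide +kernel

theorem connected_lam (n : ℕ) : (Lam n).Connected := by
  let S : AddSubgroup (Fin 4 → ZMod n) :=
    { carrier := {x | ∀ y, (Lam n).Reachable (1, y) (1, y + x)}
      zero_mem' := fun y => by rw [add_zero]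
      add_mem' := fun {a b} ha hb y => by
        rw [← add_assoc]
        exact (ha y).trans (hb (y + a))
      neg_mem' := fun {a} ha y => by
        have := ha (y + -a)
        rw [neg_add_cancel_right] at this
        exact this.symm }
  have hS : ∀ x, x ∈ S := by
    intro x
    obtain ⟨x, rfl⟩ := reduceMod_surjective n x
    rw [show x = ∑ i, x i • (Pi.single i 1 : Fin 4 → ℤ) by
      funext j; simp [Finset.sum_apply, Pi.single_apply], map_sum]
    refine S.sum_mem fun i _ => ?_
    rw [map_zsmul]
    refine S.zsmul_mem (fun y => ?_) _
    obtain ⟨w, -, hw⟩ := exists_walk_translation i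
    exact reachable_of_foldl_intNeighbor n hw y
  have hbase : ∀ p, (Lam n).Reachable (1, 0) p := by
    rintro ⟨g, x⟩
    obtain ⟨w, -, hw⟩ := exists_walk_to_fibre g
    have h1 := hS x 0
    have h2 := reachable_of_foldl_intNeighbor n hw x
    rw [zero_add] at h1
    rw [map_zero, add_zero] at h2
    exact h1.trans h2
  have : Nonempty (MKGroup × (Fin 4 → ZMod n)) := ⟨(1, 0)⟩
  exact ⟨fun p q => (hbase p).symm.trans (hbase q)⟩

/-! ### Lifting automorphisms of the Möbius–Kantor graph to `Lam n`. -/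

/-- A label permuting involution of `Lam n`, from the integral data of an affine lift of an
automorphism of the Möbius–Kantor graph. -/
theorem exists_permutesLabels_of_affine (n : ℕ) (φ : MKGroup → MKGroup)
    (M : Matrix (Fin 4) (Fin 4) ℤ) (t : MKGroup → Fin 4 → ℤ) (σ : Equiv.Perm (Fin 3))
    (hφ : ∀ g, φ (φ g) = g) (hM : M * M = 1) (ht : ∀ g, M.mulVec (t g) + t (φ g) = 0)
    (hlabel : ∀ k g, φ (labelGen k * g) = labelGen (σ k) * φ g)
    (hvoltage : ∀ k g, M.mulVec (intVoltage g (labelGen k * g)) + t (labelGen k * g) =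
      t g + intVoltage (φ g) (labelGen (σ k) * φ g)) :
    ∃ h : Equiv.Perm (MKGroup × (Fin 4 → ZMod n)), PermutesLabels (lamNeighbor n) h σ ∧
      h (1, 0) = reduceVertex n (φ 1, t 1) := by
  -- The lift is `(g, x) ↦ (φ g, M x + t g)`. `hvoltage` says that it respects adjacency, while
  -- `hφ`, `hM` and `ht` make it an involution.
  let f : MKGroup × (Fin 4 → ZMod n) → MKGroup × (Fin 4 → ZMod n) := fun p =>
    (φ p.1, (M.map ((↑) : ℤ → ZMod n)).mulVec p.2 + reduceMod n (t p.1))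
  have hf : ∀ p, f (reduceVertex n p) = reduceVertex n (φ p.1, M.mulVec p.2 + t p.1) := fun p => by
    simp only [f, reduceVertex, map_add, reduceMod_mulVec]
  have hsurj : ∀ p, ∃ q, reduceVertex n q = p := fun p => by
    obtain ⟨x, hx⟩ := reduceMod_surjective n p.2
    exact ⟨(p.1, x), Prod.ext rfl hx⟩
  have hinv : Function.Involutive f := fun p => by
    obtain ⟨⟨g, x⟩, rfl⟩ := hsurj p
    rw [hf, hf]
    simp only [hφ, Matrix.mulVec_add, Matrix.mulVec_mulVec, hM, Matrix.one_mulVec, add_assoc, ht,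
      add_zero]
  refine ⟨hinv.toPerm f, fun k p => ?_, ?_⟩
  · obtain ⟨⟨g, x⟩, rfl⟩ := hsurj p
    rw [lamNeighbor_reduceVertex]
    simp only [Function.Involutive.coe_toPerm]
    rw [hf, hf, lamNeighbor_reduceVertex]
    simp only [intNeighbor, hlabel, Matrix.mulVec_add, add_assoc, hvoltage]
  · rw [Function.Involutive.coe_toPerm, show ((1, 0) : MKGroup × (Fin 4 → ZMod n)) =
      reduceVertex n (1, 0) by rw [reduceVertex, map_zero], hf, Matrix.mulVec_zero, zero_add]

/-- Right multiplication by `c` commutes with the left multiplications that define the edges, so it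
fixes the labels. It reflects the 8-cycle, and the matrix is the induced signed permutation of the
voltages; the constant translation sends the base vertex to its neighbour `(c, e₁)`. -/
theorem exists_permutesLabels_translation (n : ℕ) :
    ∃ h, PermutesLabels (lamNeighbor n) h 1 ∧ h (1, 0) = lamNeighbor n 2 (1, 0) := by
  obtain ⟨h, hh, h1⟩ := exists_permutesLabels_of_affine n (fun g => g * .c)
    !![-1, 0, 0, 0; 0, 0, 0, 1; 0, 0, 1, 0; 0, 1, 0, 0] (fun _ => ![1, 0, 0, 0]) 1
    (by decide +kernel) (by decide +kernel) (by decide +kernel) (by decide +kernel)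
    (by decide +kernel)
  refine ⟨h, hh, h1.trans ?_⟩
  rw [show ((1, 0) : MKGroup × (Fin 4 → ZMod n)) = reduceVertex n (1, 0) by
    rw [reduceVertex, map_zero], lamNeighbor_reduceVertex]
  congr 1
  decide +kernel

/-- The automorphism of `R` exchanging `b` and `c` reflects the 8-cycle and fixes 1, so no
translation is needed. The term `g.j * g.k` comes from reordering `cʲ bᵏ`. -/
theorem exists_permutesLabels_swap_one_two (n : ℕ) :
    ∃ h, PermutesLabels (lamNeighbor n) h (Equiv.swap 1 2) ∧ h (1, 0) = (1, 0) := by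
  obtain ⟨h, hh, h1⟩ := exists_permutesLabels_of_affine n (fun g => ⟨g.i, g.k, g.j, g.l + g.j * g.k⟩)
    !![0, 0, 0, 1; 0, 0, 1, 0; 0, 1, 0, 0; 1, 0, 0, 0] (fun _ => 0) (Equiv.swap 1 2)
    (by decide +kernel) (by decide +kernel) (by decide +kernel) (by decide +kernel)
    (by decide +kernel)
  exact ⟨h, hh, h1.trans (Prod.ext rfl (map_zero (reduceMod n)))⟩

/-- The position of an element of `R` in the lexicographic order of the exponents. -/
def lexIndex (g : MKGroup) : ℕ := 8 * g.i.val + 4 * g.j.val + 2 * g.k.val + g.l.val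

/-- The translation part of the lift of the automorphism of `R` that exchanges `a` and `b`. -/
def swapTranslation (g : MKGroup) : Fin 4 → ℤ :=
  ([![0, 0, 0, 0], ![0, 0, 1, 2], ![0, -1, 0, 1], ![0, 1, 1, 1],
    ![0, 0, 1, 1], ![0, 0, 0, 1], ![0, 0, 1, 1], ![0, 0, 0, 1],
    ![0, 0, 0, 1], ![0, 0, 1, 1], ![0, 0, 0, 1], ![0, 0, 1, 1],
    ![0, 0, 1, 1], ![0, 0, 0, 1], ![0, 0, 1, 1], ![0, 0, 0, 1]] : List (Fin 4 → ℤ)).getD (lexIndex g) 0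

theorem exists_permutesLabels_swap_zero_one (n : ℕ) :
    ∃ h, PermutesLabels (lamNeighbor n) h (Equiv.swap 0 1) ∧ h (1, 0) = (1, 0) := by
  -- Exchanging `a` and `b` moves the 8-cycle off itself. The voltages then agree only up to the
  -- vertex potential `swapTranslation`.
  obtain ⟨h, hh, h1⟩ := exists_permutesLabels_of_affine n (fun g => ⟨g.j, g.i, g.k, g.l + g.i * g.j⟩)
    !![1, 0, 0, 0; 1, -1, 0, 0; 0, -1, 1, -1; -1, 0, 0, -1] swapTranslation (Equiv.swap 0 1)
    (by decide +kernel) (by decide +kernel) (by decide +kernel) (by decide +kernel)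
    (by decide +kernel)
  exact ⟨h, hh, h1.trans (Prod.ext rfl
    ((congrArg _ (by decide +kernel : swapTranslation 1 = 0)).trans (map_zero (reduceMod n))))⟩

theorem exists_permutesLabels_fix_base (n : ℕ) (σ : Equiv.Perm (Fin 3)) :
    ∃ h, PermutesLabels (lamNeighbor n) h σ ∧ h (1, 0) = (1, 0) := by
  obtain ⟨r, hr, hr1⟩ := exists_permutesLabels_swap_zero_one n
  obtain ⟨q, hq, hq1⟩ := exists_permutesLabels_swap_one_two n
  have key : ∀ σ : Equiv.Perm (Fin 3), σ = 1 ∨ σ = Equiv.swap 0 1 ∨ σ = Equiv.swap 1 2 ∨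
      σ = Equiv.swap 0 1 * Equiv.swap 1 2 ∨ σ = Equiv.swap 1 2 * Equiv.swap 0 1 ∨
      σ = Equiv.swap 0 1 * (Equiv.swap 1 2 * Equiv.swap 0 1) := by decide
  rcases key σ with rfl | rfl | rfl | rfl | rfl | rfl
  · exact ⟨1, .one _, rfl⟩
  · exact ⟨r, hr, hr1⟩
  · exact ⟨q, hq, hq1⟩
  · exact ⟨r * q, hr.mul hq, by simp [hr1, hq1]⟩
  · exact ⟨q * r, hq.mul hr, by simp [hr1, hq1]⟩
  · exact ⟨r * (q * r), hr.mul (hq.mul hr), by simp [hr1, hq1]⟩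

theorem hasTransitiveLabels_lamNeighbor (n : ℕ) : HasTransitiveLabels (lamNeighbor n) := by
  have hneighbor : ∀ k, ∃ h, PermutesLabels (lamNeighbor n) h 1 ∧
      h (1, 0) = lamNeighbor n k (1, 0) := fun k => by
    obtain ⟨h, hh, h1⟩ := exists_permutesLabels_translation n
    obtain ⟨r, hr, hr1⟩ := exists_permutesLabels_fix_base n (Equiv.swap 2 k)
    -- Conjugation by `r`, which fixes the base vertex and carries label 2 to `k`, turns a move
    -- along label 2 into one along `k`.
    refine ⟨r * h * r⁻¹, by simpa using (hr.mul hh).mul hr.inv, ?_⟩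
    have : r⁻¹ (1, 0) = (1, 0) := by rw [Equiv.Perm.inv_eq_iff_eq, hr1]
    rw [Equiv.Perm.mul_apply, Equiv.Perm.mul_apply, this, h1, hr, hr1, Equiv.swap_apply_left]
  have hwalk : ∀ {p q} (_ : (Lam n).Walk p q), p = (1, 0) →
      ∃ h, PermutesLabels (lamNeighbor n) h 1 ∧ h (1, 0) = q := by
    intro p q w hp
    induction w using SimpleGraph.Walk.concatRec with
    | Hnil => exact ⟨1, .one _, hp.symm⟩
    | Hconcat w hadj ih =>
      obtain ⟨h, hh, rfl⟩ := ih hp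
      obtain ⟨k, rfl⟩ := ((isCubicLabelling_lamNeighbor n).adj_iff _ _).1 hadj
      obtain ⟨h', hh', h1⟩ := hneighbor k
      -- As `h` preserves labels, it sends the `k`-neighbour of the base vertex to the `k`-neighbour
      -- of its own image.
      exact ⟨h * h', hh.mul hh', by rw [Equiv.Perm.mul_apply, h1, hh]; rfl⟩
  have hbase : ∀ q, ∃ h, PermutesLabels (lamNeighbor n) h 1 ∧ h (1, 0) = q := fun q => by
    obtain ⟨w⟩ := (connected_lam n).preconnected (1, 0) q
    exact hwalk w rfl
  intro u v σ
  obtain ⟨g, hg, rfl⟩ := hbase u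
  obtain ⟨h, hh, rfl⟩ := hbase v
  obtain ⟨r, hr, hr1⟩ := exists_permutesLabels_fix_base n σ
  exact ⟨h * r * g⁻¹, by simpa using (hh.mul hr).mul hg.inv, by simp [hr1]⟩

/-! ### A codeword of bounded weight. -/

/-- The support of a word of the code `ker (A + I)` of the `ℤ⁴`-cover, fibre by fibre. -/
def codewordFibre (g : MKGroup) : List (Fin 4 → ℤ) :=
  ([
    [![0, 0, -1, 0], ![0, 0, 0, 0], ![0, 1, 0, 0], ![0, 1, 1, 0]],
    [![1, 0, -1, 0], ![1, 0, 0, 0], ![1, 1, 0, 0], ![1, 1, 1, 0]],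
    [![1, 0, -1, -1], ![1, 0, -1, 0], ![1, 0, 0, -1], ![1, 0, 0, 0]],
    [![0, 1, 0, 0], ![0, 1, 0, 1], ![0, 1, 1, 0], ![0, 1, 1, 1]],
    [![0, 0, -1, 0], ![0, 0, 0, 0], ![0, 0, 0, 1], ![0, 1, 0, 1],
      ![1, 0, -1, 0], ![1, 1, 0, 0]],
    [![0, 0, 0, 0], ![0, 1, 1, 0], ![1, 0, 0, -1], ![1, 1, 0, -1],
      ![1, 1, 0, 0], ![1, 1, 1, 0]],
    [![0, 1, 0, 0], ![0, 1, 0, 1], ![1, 1, 0, -1], ![1, 1, 0, 0]],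
    [![0, 0, 0, 0], ![0, 0, 0, 1], ![1, 0, 0, -1], ![1, 0, 0, 0]],
    [![0, 0, 0, 0], ![0, 1, 1, 0], ![1, 0, -1, -1], ![1, 1, 0, -1]],
    [![0, 0, 0, 1], ![0, 1, 1, 1], ![1, 0, -1, 0], ![1, 1, 0, 0]],
    [![0, 0, 0, 0], ![0, 0, 0, 1], ![1, 0, -1, -1], ![1, 0, 0, 0],
      ![1, 1, 0, 0], ![1, 1, 1, 0]],
    [![0, 0, -1, 0], ![0, 0, 0, 0], ![0, 1, 0, 0], ![0, 1, 1, 1],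
      ![1, 1, 0, -1], ![1, 1, 0, 0]],
    [![0, 0, 0, 0], ![0, 1, 1, 1], ![1, 0, -1, -1], ![1, 1, 0, 0]],
    [![0, 0, 0, 0], ![0, 1, 1, 1], ![1, 0, -1, -1], ![1, 1, 0, 0]],
    [![0, 0, -1, 0], ![0, 1, 0, 1], ![1, 0, -1, -1], ![1, 1, 0, 0]],
    [![0, 0, 0, 0], ![0, 1, 1, 1], ![1, 0, 0, -1], ![1, 1, 1, 0]]] : List (List (Fin 4 → ℤ))).getD (lexIndex g) []

/-- The vertices in a fibre that are in the closed neighbourhood of a vertex of the support, with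
multiplicity. -/
def closedNeighborFibre (g : MKGroup) : List (Fin 4 → ℤ) :=
  codewordFibre g ++ (List.finRange 3).flatMap fun k =>
    (codewordFibre (labelGen k * g)).map fun x => x - intVoltage g (labelGen k * g)

theorem even_count_closedNeighborFibre : ∀ g, ∀ x ∈ closedNeighborFibre g,
    Even ((closedNeighborFibre g).count x) := by
  decide +kernel

/-- The number modulo 2 of elements of a list of integral vectors that reduce to `y`. -/
def reducedCount (n : ℕ) (y : Fin 4 → ZMod n) (L : List (Fin 4 → ℤ)) : ZMod 2 :=
  (L.map fun x => if reduceMod n x = y then 1 else 0).sum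

theorem reducedCount_append (n : ℕ) (y : Fin 4 → ZMod n) (L L' : List (Fin 4 → ℤ)) :
    reducedCount n y (L ++ L') = reducedCount n y L + reducedCount n y L' := by
  rw [reducedCount, List.map_append, List.sum_append]; rfl

theorem reducedCount_map_sub (n : ℕ) (y : Fin 4 → ZMod n) (v : Fin 4 → ℤ)
    (L : List (Fin 4 → ℤ)) :
    reducedCount n y (L.map fun x => x - v) = reducedCount n (y + reduceMod n v) L := by
  simp only [reducedCount, List.map_map, Function.comp_def, map_sub, sub_eq_iff_eq_add]

theorem reducedCount_eq_zero_of_even {n : ℕ} (y : Fin 4 → ZMod n) {L : List (Fin 4 → ℤ)}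
    (hL : ∀ x ∈ L, Even (L.count x)) : reducedCount n y L = 0 := by
  rw [reducedCount, Finset.sum_list_map_count]
  refine Finset.sum_eq_zero fun x hx => ?_
  obtain ⟨m, hm⟩ := hL x (List.mem_toFinset.1 hx)
  rw [hm, ← two_mul, mul_smul, two_smul]
  exact CharTwo.add_self_eq_zero _

/-- The word of the code of `Lam n` obtained by reduction modulo `n`. -/
def lamCodeword (n : ℕ) (p : MKGroup × (Fin 4 → ZMod n)) : ZMod 2 :=
  reducedCount n p.2 (codewordFibre p.1)

/-- In the `ℤ⁴`-cover every vertex is hit an even number of times by the closed neighbourhoods of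
the support. Summing over the preimages of a vertex modulo `n` keeps the count even, even if points
of the support become equal. -/
theorem closedSum_lamCodeword (n : ℕ) : closedSum (lamNeighbor n) (lamCodeword n) = 0 := by
  funext p
  rw [closedSum_apply, Pi.zero_apply,
    ← reducedCount_eq_zero_of_even p.2 (even_count_closedNeighborFibre p.1), closedNeighborFibre,
    reducedCount_append]
  simp only [List.finRange_succ, List.finRange_zero, List.map_cons, List.map_nil,
    List.flatMap_cons, List.flatMap_nil, List.append_nil, reducedCount_append,
    reducedCount_map_sub, Fin.sum_univ_three, lamCodeword, lamNeighbor, mkVoltage_eq_reduceMod,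
    add_assoc]
  rfl

theorem card_support_lamCodeword (n : ℕ) [NeZero n] :
    (Finset.univ.filter fun v => lamCodeword n v ≠ 0).card ≤ 72 := by
  have hsub : (Finset.univ.filter fun v => lamCodeword n v ≠ 0) ⊆
      Finset.univ.biUnion fun g => ((codewordFibre g).map fun x => (g, reduceMod n x)).toFinset := by
    rintro ⟨g, y⟩ hv
    simp only [Finset.mem_biUnion, Finset.mem_univ, true_and, List.mem_toFinset, List.mem_map,
      Prod.mk.injEq]
    by_contra! hmem
    refine (Finset.mem_filter.1 hv).2 (List.sum_eq_zero fun z hz => ?_)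
    obtain ⟨x, hx, rfl⟩ := List.mem_map.1 hz
    exact if_neg (hmem g x hx rfl)
  calc (Finset.univ.filter fun v => lamCodeword n v ≠ 0).card
      ≤ ∑ g, ((codewordFibre g).map fun x => (g, reduceMod n x)).toFinset.card :=
        (Finset.card_le_card hsub).trans Finset.card_biUnion_le
    _ ≤ ∑ g, (codewordFibre g).length := Finset.sum_le_sum fun g _ =>
        (List.toFinset_card_le _).trans_eq (List.length_map _)
    _ ≤ 72 := by decide +kernel

/-- Coordinates differ by at most 2, less than `n`. As the listed support lies in this cube, values
of the reduced word there can be read off the integral list. -/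
theorem reduceMod_injOn {n : ℕ} (hn : 3 ≤ n) {x y : Fin 4 → ℤ} (hx : ∀ i, |x i| ≤ 1)
    (hy : ∀ i, |y i| ≤ 1) (h : reduceMod n x = reduceMod n y) : x = y := by
  funext i
  have hi : (x i : ZMod n) = y i := congrFun h i
  rw [ZMod.intCast_eq_intCast_iff_dvd_sub] at hi
  have hxi := abs_le.1 (hx i)
  have hyi := abs_le.1 (hy i)
  have := Int.eq_zero_of_abs_lt_dvd hi (by rw [abs_lt]; constructor <;> omega)
  omega

theorem lamCodeword_reduceVertex {n : ℕ} (hn : 3 ≤ n) (q : MKGroup × (Fin 4 → ℤ))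
    (hq : ∀ i, |q.2 i| ≤ 1) :
    lamCodeword n (reduceVertex n q) = (codewordFibre q.1).count q.2 := by
  have key : ∀ L : List (Fin 4 → ℤ), (∀ x ∈ L, ∀ i, |x i| ≤ 1) →
      reducedCount n (reduceMod n q.2) L = L.count q.2 := by
    intro L
    induction L with
    | nil => exact fun _ => by simp [reducedCount]
    | cons x L ih =>
      intro hL
      rw [List.forall_mem_cons] at hL
      rw [List.count_cons, Nat.cast_add, add_comm, ← ih hL.2, reducedCount, List.map_cons,
        List.sum_cons]
      congr 1
      by_cases h : x = q.2
      · simp [h]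
      · rw [if_neg fun h' => h (reduceMod_injOn hn hL.1 hq h')]
        simp [h]
  exact key _ ((by decide +kernel : ∀ g, ∀ x ∈ codewordFibre g, ∀ i, |x i| ≤ 1) q.1)

/-- Each generator changes the parity of `i + j + k`, so a closed neighbourhood contains either one
or three vertices of value 1. -/
theorem closedSum_bipartition (n : ℕ) :
    closedSum (lamNeighbor n) (fun p => p.1.i + p.1.j + p.1.k) = 1 := by
  have key : ∀ g : MKGroup, (g.i + g.j + g.k) + ∑ k, ((labelGen k * g).i + (labelGen k * g).j +
      (labelGen k * g).k) = 1 := by decide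
  funext p
  exact key p.1

end Cover

/-! ### The final estimate and the theorem. -/

section Main

theorem exists_sign_eq_one_apply_eq :
    ∀ k l : Fin 3, ∃ σ : Equiv.Perm (Fin 3), Equiv.Perm.sign σ = 1 ∧ σ k = l := by
  decide

/-- The group of signed permutations with sign condition `Q` and twist `χ` arises as the local
action on `Gam n` of a group with exponentially large arc-stabilisers. -/
theorem gamHasLargeGroup_of_permIsomorphic {Ω : Type*} {L : Subgroup (Equiv.Perm Ω)}
    (Q : Subgroup ℤˣ) (χ : Equiv.Perm (Fin 3) →* Multiplicative (ZMod 2))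
    (hL : PermIsomorphic L (signedPermGroup (Q.comap Equiv.Perm.sign) χ)) {n : ℕ} (hn : 3 ≤ n) :
    GamHasLargeGroup L ((2 : ℝ) ^ (1 / 162 : ℝ)) n := by
  have : NeZero n := ⟨by omega⟩
  have hs := isCubicLabelling_lamNeighbor n
  have ht := hasTransitiveLabels_lamNeighbor n
  have hc := closedSum_lamCodeword n
  have hone : lamCodeword n (reduceVertex n (⟨0, 0, 0, 0⟩, ![0, 0, -1, 0])) = 1 := by
    rw [lamCodeword_reduceVertex hn _ (by decide)]
    exact congrArg (Nat.cast : ℕ → ZMod 2) (by decide +kernel :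
      (codewordFibre ⟨0, 0, 0, 0⟩).count ![0, 0, -1, 0] = 1)
  have hzero : lamCodeword n (reduceVertex n (⟨1, 0, 0, 0⟩, ![0, 0, -1, 0])) = 0 := by
    rw [lamCodeword_reduceVertex hn _ (by decide)]
    exact congrArg (Nat.cast : ℕ → ZMod 2) (by decide +kernel :
      (codewordFibre ⟨1, 0, 0, 0⟩).count ![0, 0, -1, 0] = 0)
  have hadj : lamCodeword n
      (lamNeighbor n 0 (reduceVertex n (⟨1, 0, 0, 0⟩, ![0, 0, -1, 0]))) = 1 := by
    rw [lamNeighbor_reduceVertex, show intNeighbor 0 (⟨1, 0, 0, 0⟩, ![0, 0, -1, 0]) =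
      (⟨0, 0, 0, 0⟩, ![0, 0, -1, 0]) by decide +kernel, hone]
  have hw := closedSum_bipartition n
  refine ⟨twistedGroup (Lam n) (lamNeighbor n) (Q.comap Equiv.Perm.sign) χ, ⟨inferInstance,
    connected_lexProduct (connected_lam n) fun v => ⟨_, adj_lamNeighbor n 0 v⟩,
    isArcTransitive_twistedGroup hs ht hc hzero hadj hw (fun k l => ?_) χ, fun v => hL.trans
      (permIsomorphic_localAction_twistedGroup hs ht hc hzero hadj hw _ χ v)⟩, fun u v _ => ?_⟩
  · obtain ⟨σ, hσ, h⟩ := exists_sign_eq_one_apply_eq k l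
    exact ⟨σ, by rw [Subgroup.mem_comap, hσ]; exact one_mem Q, h⟩
  · have hdim := card_le_mul_finrank_ker_closedSum ht hc hone (card_support_lamCodeword n)
    have hcard : Fintype.card (MKGroup × (Fin 4 → ZMod n)) = 16 * n ^ 4 := by
      rw [Fintype.card_prod, Fintype.card_fun, ZMod.card, Fintype.card_fin]
      rfl
    have hcard' : Nat.card ((MKGroup × (Fin 4 → ZMod n)) × ZMod 2) = 16 * n ^ 4 * 2 := by
      rw [Nat.card_prod, Nat.card_eq_fintype_card, hcard, Nat.card_zmod]
    have hn4 : 3 ^ 4 ≤ n ^ 4 := Nat.pow_le_pow_left hn 4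
    rw [hcard] at hdim
    rw [hcard']
    set d := Module.finrank (ZMod 2) (LinearMap.ker (closedSum (lamNeighbor n)))
    -- From `16 n⁴ ≤ 72 d` the left side is at most `144 d`, and `144 d ≤ 162 (d - 2)` once `d ≥
    -- 18`. That is what `n ≥ 3` gives, since `16 · 81 / 72 = 18`.
    have hexp : 16 * n ^ 4 * 2 ≤ 162 * (d - 2) := by omega
    calc ((2 : ℝ) ^ (1 / 162 : ℝ)) ^ (16 * n ^ 4 * 2)
        ≤ ((2 : ℝ) ^ (1 / 162 : ℝ)) ^ (162 * (d - 2)) :=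
          pow_le_pow_right₀ (Real.one_le_rpow one_le_two (by norm_num)) hexp
      _ = 2 ^ (d - 2) := by
          rw [pow_mul, ← Real.rpow_natCast _ 162, ← Real.rpow_mul zero_le_two]
          norm_num
      _ ≤ _ := by exact_mod_cast two_pow_le_card_arcStabilizer hs _ χ u v

theorem isOfExponentialType_of_gamHasLargeGroup {Ω : Type*} {L : Subgroup (Equiv.Perm Ω)} {b : ℝ}
    (hb : 1 < b) (h : ∀ n, 3 ≤ n → GamHasLargeGroup L b n) : IsOfExponentialType L := by
  refine ⟨b, hb, fun N => ?_⟩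
  obtain ⟨G, hG, hcard⟩ := h (max 3 N) (le_max_left _ _)
  refine ⟨_, _, G, hG, ?_, hcard⟩
  rw [Nat.card_prod, Nat.card_prod, Nat.card_fun, Nat.card_zmod, Nat.card_zmod, Nat.card_fin]
  calc N ≤ max 3 N := le_max_right _ _
    _ ≤ max 3 N ^ 4 := Nat.le_self_pow (by norm_num) _
    _ ≤ Nat.card MKGroup * max 3 N ^ 4 := Nat.le_mul_of_pos_left _ Nat.card_pos
    _ ≤ _ := Nat.le_mul_of_pos_right _ two_pos

theorem theorem1 :
    (IsOfExponentialType A4_6 ∧ IsOfExponentialType S4_6d ∧ IsOfExponentialType S4_6c) ∧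
    ∃ b : ℝ, 1 < b ∧ ∀ n : ℕ, 3 ≤ n →
      GamHasLargeGroup A4_6 b n ∧ GamHasLargeGroup S4_6d b n ∧ GamHasLargeGroup S4_6c b n := by
  have hb : (1 : ℝ) < 2 ^ (1 / 162 : ℝ) := Real.one_lt_rpow one_lt_two (by norm_num)
  have hA : ∀ n, 3 ≤ n → GamHasLargeGroup A4_6 _ n := fun n hn =>
    gamHasLargeGroup_of_permIsomorphic _ _ permIsomorphic_A4_6 hn
  have hd : ∀ n, 3 ≤ n → GamHasLargeGroup S4_6d _ n := fun n hn =>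
    gamHasLargeGroup_of_permIsomorphic _ _ permIsomorphic_S4_6d hn
  have hc : ∀ n, 3 ≤ n → GamHasLargeGroup S4_6c _ n := fun n hn =>
    gamHasLargeGroup_of_permIsomorphic _ _ permIsomorphic_S4_6c hn
  exact ⟨⟨isOfExponentialType_of_gamHasLargeGroup hb hA,
    isOfExponentialType_of_gamHasLargeGroup hb hd,
    isOfExponentialType_of_gamHasLargeGroup hb hc⟩, _, hb, fun n hn => ⟨hA n hn, hd n hn, hc n hn⟩⟩

end Main
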